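/- Let $(M,g)$ be a smooth, connected, Hausdorff pseudo-Riemannian manifold (arbitrary signature) of dimension $n\ge 5$, with Levi-Civita connection $\nabla$. Let $C_{jklm}=C_{jkl}{}^{p}g_{pm}$ be its Weyl tensor, $$C_{jkl}{}^m = R_{jkl}{}^m+\frac{1}{n-2}\left(\delta_j{}^mR_{kl}-\delta_k{}^mR_{jl}+R_j{}^mg_{kl}-R_k{}^mg_{jl}\right)-R\,\frac{\delta_j{}^mg_{kl}-\delta_k{}^mg_{jl}}{(n-1)(n-2)},$$ where the Riemann tensor has the sign for which $[\nabla_j,\nabla_k]\omega_l=R_{jkl}{}^m\omega_m$, $R_{kl}=-R_{mkl}{}^m$ and $R=g^{kl}R_{kl}$. Suppose that $M$ is conformally recurrent, i.e. there is a non-zero smooth covector field $\alpha$ with $\nabla_iC_{jklm}=\alpha_iC_{jklm}$. Then, at every point where $\alpha^2=\alpha^i\alpha_i\neq0$ (hence on all of $M$ if $\alpha^2\ne 0$ everywhere), the tensor $E_{il}=C_{ijkl}\alpha^j\alpha^k/\alpha^2$ is symmetric and traceless ($g^{il}E_{il}=0$), the Weyl tensor is the Kulkarni–Nomizu product of $\frac{1}{n-3}\left[g-(n-2)\,\alpha\otimes\alpha/\alpha^2\right]$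 and $E$, that is, $$C_{jklm}=\frac{1}{n-3}\left[g_{km}E_{jl}-g_{jm}E_{kl}+g_{jl}E_{km}-g_{kl}E_{jm}\right]-\frac{n-2}{n-3}\left[\frac{\alpha_k\alpha_m}{\alpha^2}E_{jl}-\frac{\alpha_j\alpha_m}{\alpha^2}E_{kl}+\frac{\alpha_j\alpha_l}{\alpha^2}E_{km}-\frac{\alpha_k\alpha_l}{\alpha^2}E_{jm}\right],$$ and $$C_{jklm}C^{jklm}=4\,\frac{n-2}{n-3}\,E_{ij}E^{ij}.$$ -/

import Mathlib

open scoped Manifold ContDiff Bundle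

noncomputable section

/-- The coordinate space `ℝⁿ`. -/
abbrev Coord (n : ℕ) : Type := EuclideanSpace ℝ (Fin n)

/-- The partial derivative `∂ᵢ f` at `y`. -/
def pd {n : ℕ} (i : Fin n) (f : Coord n → ℝ) (y : Coord n) : ℝ :=
  fderiv ℝ f y (EuclideanSpace.single i (1 : ℝ))

/-! ### Tensor calculus in coordinates

`G y` is the matrix `(g_{ij})` of the components of a metric at the point with coordinates `y`;
its inverse is `(g^{ij})`. In the names below the indices are written in the order of the
classical notation. -/

/-- The Christoffel symbols `Γ^k_{ij}` of the Levi-Civita connection. -/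
def christoffel {n : ℕ} (G : Coord n → Matrix (Fin n) (Fin n) ℝ) (k i j : Fin n)
    (y : Coord n) : ℝ :=
  (1 / 2) * ∑ l, (G y)⁻¹ k l *
    (pd i (fun z => G z j l) y + pd j (fun z => G z i l) y - pd l (fun z => G z i j) y)

/-- The Riemann tensor `R_{jkl}{}^m`, with the sign for which
`[∇_j, ∇_k] ω_l = R_{jkl}{}^m ω_m`. -/
def riemann {n : ℕ} (G : Coord n → Matrix (Fin n) (Fin n) ℝ) (j k l m : Fin n)
    (y : Coord n) : ℝ :=
  pd k (christoffel G m j l) y - pd j (christoffel G m k l) y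
    + ∑ p, (christoffel G m k p y * christoffel G p j l y
      - christoffel G m j p y * christoffel G p k l y)

/-- The Ricci tensor `R_{kl} = - R_{mkl}{}^m`. -/
def ricci {n : ℕ} (G : Coord n → Matrix (Fin n) (Fin n) ℝ) (k l : Fin n) (y : Coord n) : ℝ :=
  -∑ m, riemann G m k l m y

/-- The Ricci tensor with its second index raised, `R_k{}^m = R_{kp} g^{pm}`. -/
def ricciUp {n : ℕ} (G : Coord n → Matrix (Fin n) (Fin n) ℝ) (k m : Fin n) (y : Coord n) : ℝ :=
  ∑ p, ricci G k p y * (G y)⁻¹ p m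

/-- The scalar curvature `R = g^{ij} R_{ij}`. -/
def scalarCurv {n : ℕ} (G : Coord n → Matrix (Fin n) (Fin n) ℝ) (y : Coord n) : ℝ :=
  ∑ i, ∑ j, (G y)⁻¹ i j * ricci G i j y

/-- The Kronecker delta. -/
def kron {n : ℕ} (i j : Fin n) : ℝ := if i = j then 1 else 0

/-- The Weyl tensor `C_{jkl}{}^m`. -/
def weylUp {n : ℕ} (G : Coord n → Matrix (Fin n) (Fin n) ℝ) (j k l m : Fin n)
    (y : Coord n) : ℝ :=
  riemann G j k l m y
    + 1 / ((n : ℝ) - 2) * (kron j m * ricci G k l y - kron k m * ricci G j l y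
      + ricciUp G j m y * G y k l - ricciUp G k m y * G y j l)
    - scalarCurv G y * ((kron j m * G y k l - kron k m * G y j l)
      / (((n : ℝ) - 1) * ((n : ℝ) - 2)))

/-- The Weyl tensor with all indices down, `C_{jklm} = C_{jkl}{}^p g_{pm}`. -/
def weyl {n : ℕ} (G : Coord n → Matrix (Fin n) (Fin n) ℝ) (j k l m : Fin n)
    (y : Coord n) : ℝ :=
  ∑ p, weylUp G j k l p y * G y p m

/-- The covariant derivative `∇_i T_{jklm}` of a covariant tensor field of rank four. -/
def covDeriv4 {n : ℕ} (G : Coord n → Matrix (Fin n) (Fin n) ℝ)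
    (T : Fin n → Fin n → Fin n → Fin n → Coord n → ℝ) (i j k l m : Fin n) (y : Coord n) : ℝ :=
  pd i (T j k l m) y
    - ∑ p, (christoffel G p i j y * T p k l m y + christoffel G p i k y * T j p l m y
      + christoffel G p i l y * T j k p m y + christoffel G p i m y * T j k l p y)

/-! ### Algebra at a point

Here `g` is a symmetric invertible matrix `(g_{ij})`. -/

/-- `α^i = g^{ij} α_j`. -/
def raise {n : ℕ} (g : Matrix (Fin n) (Fin n) ℝ) (a : Fin n → ℝ) (i : Fin n) : ℝ :=
  ∑ j, g⁻¹ i j * a j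

/-- `α² = α^i α_i`. -/
def normSqForm {n : ℕ} (g : Matrix (Fin n) (Fin n) ℝ) (a : Fin n → ℝ) : ℝ :=
  ∑ i, raise g a i * a i

/-- The trace `g^{ij} S_{ij}`. -/
def trace2 {n : ℕ} (g : Matrix (Fin n) (Fin n) ℝ) (S : Fin n → Fin n → ℝ) : ℝ :=
  ∑ i, ∑ j, g⁻¹ i j * S i j

/-- The full contraction `S_{ij} S^{ij}`. -/
def normSq2 {n : ℕ} (g : Matrix (Fin n) (Fin n) ℝ) (S : Fin n → Fin n → ℝ) : ℝ :=
  ∑ i, ∑ j, S i j * ∑ p, ∑ q, g⁻¹ i p * g⁻¹ j q * S p q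

/-- The full contraction `T_{jklm} T^{jklm}`. -/
def normSq4 {n : ℕ} (g : Matrix (Fin n) (Fin n) ℝ)
    (T : Fin n → Fin n → Fin n → Fin n → ℝ) : ℝ :=
  ∑ j, ∑ k, ∑ l, ∑ m, T j k l m *
    ∑ p, ∑ q, ∑ r, ∑ s, g⁻¹ j p * g⁻¹ k q * g⁻¹ l r * g⁻¹ m s * T p q r s

/-- The tensor `E_{il} = C_{ijkl} α^j α^k / α²` made from a tensor `C` and a covector `α`. -/
def electric {n : ℕ} (g : Matrix (Fin n) (Fin n) ℝ) (a : Fin n → ℝ)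
    (C : Fin n → Fin n → Fin n → Fin n → ℝ) (i l : Fin n) : ℝ :=
  (∑ j, ∑ k, C i j k l * raise g a j * raise g a k) / normSqForm g a

/-- The Kulkarni–Nomizu product of two symmetric tensors. -/
def kulkarniNomizu {n : ℕ} (A B : Fin n → Fin n → ℝ) (j k l m : Fin n) : ℝ :=
  A j l * B k m + A k m * B j l - A j m * B k l - A k l * B j m

/-! ### Pseudo-Riemannian manifolds -/

/-- A smooth pseudo-Riemannian metric (of arbitrary signature) on a smooth manifold: a smooth
section of the bundle of bilinear forms on the tangent spaces, symmetric and nondegenerate. -/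
structure PseudoRiemannianMetric (n : ℕ) (M : Type*) [TopologicalSpace M]
    [ChartedSpace (Coord n) M] [IsManifold (𝓡 n) ∞ M] where
  /-- The bilinear form on each tangent space. -/
  form (p : M) : TangentSpace (𝓡 n) p →L[ℝ] TangentSpace (𝓡 n) p →L[ℝ] ℝ
  symm (p : M) (v w : TangentSpace (𝓡 n) p) : form p v w = form p w v
  nondegenerate (p : M) (v : TangentSpace (𝓡 n) p) (hv : ∀ w, form p v w = 0) : v = 0
  contMDiff : ContMDiff (𝓡 n) ((𝓡 n).prod 𝓘(ℝ, Coord n →L[ℝ] Coord n →L[ℝ] ℝ)) ∞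
    (fun p => Bundle.TotalSpace.mk' (Coord n →L[ℝ] Coord n →L[ℝ] ℝ)
      (E := fun p : M => TangentSpace (𝓡 n) p →L[ℝ] TangentSpace (𝓡 n) p →L[ℝ] ℝ) p (form p))

/-- A smooth covector field, that is, a smooth section of the cotangent bundle. -/
structure CovectorField (n : ℕ) (M : Type*) [TopologicalSpace M]
    [ChartedSpace (Coord n) M] [IsManifold (𝓡 n) ∞ M] where
  /-- The covector at each point. -/
  form (p : M) : TangentSpace (𝓡 n) p →L[ℝ] ℝ
  contMDiff : ContMDiff (𝓡 n) ((𝓡 n).prod 𝓘(ℝ, Coord n →L[ℝ] ℝ)) ∞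
    (fun p => Bundle.TotalSpace.mk' (Coord n →L[ℝ] ℝ)
      (E := fun p : M => TangentSpace (𝓡 n) p →L[ℝ] ℝ) p (form p))

/-- The coordinate vector field `∂_i` of the chart `e`, at the point with coordinates `y`. -/
def coordVec {n : ℕ} {M : Type*} [TopologicalSpace M] [ChartedSpace (Coord n) M]
    (e : OpenPartialHomeomorph M (Coord n)) (y : Coord n) (i : Fin n) :
    TangentSpace (𝓡 n) (e.symm y) :=
  mfderiv (𝓡 n) (𝓡 n) e.symm y (EuclideanSpace.single i (1 : ℝ) : Coord n)

/-- The components `g_{ij} = g(∂_i, ∂_j)` of a metric in the chart `e`. -/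
def PseudoRiemannianMetric.comp {n : ℕ} {M : Type*} [TopologicalSpace M]
    [ChartedSpace (Coord n) M] [IsManifold (𝓡 n) ∞ M] (g : PseudoRiemannianMetric n M)
    (e : OpenPartialHomeomorph M (Coord n)) (y : Coord n) : Matrix (Fin n) (Fin n) ℝ :=
  Matrix.of fun i j => g.form (e.symm y) (coordVec e y i) (coordVec e y j)

/-- The components `α_i = α(∂_i)` of a covector field in the chart `e`. -/
def CovectorField.comp {n : ℕ} {M : Type*} [TopologicalSpace M]
    [ChartedSpace (Coord n) M] [IsManifold (𝓡 n) ∞ M] (α : CovectorField n M)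
    (e : OpenPartialHomeomorph M (Coord n)) (y : Coord n) (i : Fin n) : ℝ :=
  α.form (e.symm y) (coordVec e y i)

/-- The components `C_{jklm}` of the Weyl tensor of `g` in the chart `e`, at the point with
coordinates `y`. -/
def PseudoRiemannianMetric.weylComp {n : ℕ} {M : Type*} [TopologicalSpace M]
    [ChartedSpace (Coord n) M] [IsManifold (𝓡 n) ∞ M] (g : PseudoRiemannianMetric n M)
    (e : OpenPartialHomeomorph M (Coord n)) (y : Coord n) (j k l m : Fin n) : ℝ :=
  weyl (g.comp e) j k l m y

/-- The function `α² = g^{ij} α_i α_j`, in the chart `e`. -/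
def CovectorField.sq {n : ℕ} {M : Type*} [TopologicalSpace M]
    [ChartedSpace (Coord n) M] [IsManifold (𝓡 n) ∞ M] (α : CovectorField n M)
    (g : PseudoRiemannianMetric n M) (e : OpenPartialHomeomorph M (Coord n)) (y : Coord n) : ℝ :=
  normSqForm (g.comp e y) (α.comp e y)

/-- The tensor `E_{il} = C_{ijkl} α^j α^k / α²` of the Weyl tensor and of `α`, in the chart `e`. -/
def PseudoRiemannianMetric.electricComp {n : ℕ} {M : Type*} [TopologicalSpace M]
    [ChartedSpace (Coord n) M] [IsManifold (𝓡 n) ∞ M] (g : PseudoRiemannianMetric n M)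
    (α : CovectorField n M) (e : OpenPartialHomeomorph M (Coord n)) (y : Coord n) :
    Fin n → Fin n → ℝ :=
  electric (g.comp e y) (α.comp e y) (g.weylComp e y)

/-- `(M, g)` is conformally recurrent with recurrence covector `α`: `α` is a non-zero covector
field, and `∇_i C_{jklm} = α_i C_{jklm}` in all charts of the smooth structure. -/
structure IsConformallyRecurrent {n : ℕ} {M : Type*} [TopologicalSpace M]
    [ChartedSpace (Coord n) M] [IsManifold (𝓡 n) ∞ M] (g : PseudoRiemannianMetric n M)
    (α : CovectorField n M) : Prop where
  ne_zero : ∃ p, α.form p ≠ 0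
  recurrent : ∀ e ∈ IsManifold.maximalAtlas (𝓡 n) ∞ M, ∀ y ∈ e.target, ∀ i j k l m : Fin n,
    covDeriv4 (g.comp e) (weyl (g.comp e)) i j k l m y
      = α.comp e y i * weyl (g.comp e) j k l m y

end

/-! The only differential input is the second Bianchi identity. Write the Weyl tensor as Riemann
plus products of the metric with the Schouten tensor. Since the metric is parallel, the cyclic sum
of `∇_i C_{jklm}` loses its Riemann part and becomes the metric times a tensor `A_{jkl}`, skew in
`j, k` (the Cotton tensor up to sign): `covDeriv4_weyl_cyclic`. Recurrence replaces `∇_i C` by `α_i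
C`, so at each point there is a purely algebraic identity for `C`, `α`, `g` and `A`.

Three contractions solve it. Tracing with `g^{im}`, and then once more, kills the trace of `A` and
gives `D_{jkl} = C_{jklm} α^m = (n-3) A_{jkl}` (`contract_eq_of_bianchi`). Contracting with `α^i`
expresses `α² C` through `D`, `E`, `g` and `α`. Contracting that with `α^m` gives `(n-4) α² (D_{jkl}
- α_j E_{kl} + α_k E_{jl}) = 0`; as `n ≥ 5` and `α² ≠ 0`, `D` is determined by `E`, hence so is `C`
(`electric_decomposition`).

For the norm, one factor of `C C` is replaced by its Kulkarni–Nomizu form. Skewness merges the four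
terms into one; the metric part then vanishes because `C` is traceless, and the `α ⊗ α` part
reproduces `E`.

In a chart the curvature is handled as matrices `R_{jk}` built from connection matrices `Γ_i`, so
that skewness and the second Bianchi identity become noncommutative polynomial identities. -/

/-! ### Tensor components in a chart: smoothness and nondegeneracy -/

section Chart

variable {n : ℕ} {M : Type*} [TopologicalSpace M] [ChartedSpace (Coord n) M]
  [IsManifold (𝓡 n) ∞ M]

/-- The coordinate vector fields of a chart are smooth on its target. -/
theorem contMDiffOn_coordVec {e : OpenPartialHomeomorph M (Coord n)}
    (he : e ∈ IsManifold.maximalAtlas (𝓡 n) ∞ M) (i : Fin n) :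
    ContMDiffOn (𝓡 n) (𝓡 n).tangent ∞
      (fun y => Bundle.TotalSpace.mk' (Coord n) (E := (TangentSpace (𝓡 n) : M → Type _))
        (e.symm y) (coordVec e y i)) e.target := by
  have h1 : ContMDiffOn (𝓡 n) (𝓡 n) ∞ e.symm e.target :=
    contMDiffOn_symm_of_mem_maximalAtlas he
  -- The coordinate field is the tangent map of `e.symm` applied to a constant field of `ℝⁿ`, so it
  -- inherits smoothness from both.
  have h2 := h1.contMDiffOn_tangentMapWithin (m := ∞) (by simp) e.open_target.uniqueMDiffOn
  have h3 : ContMDiff (𝓡 n) (𝓡 n).tangent ∞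
      (fun y : Coord n => (⟨y, EuclideanSpace.single i (1 : ℝ)⟩ :
        TangentBundle (𝓡 n) (Coord n))) := by
    exact contMDiff_vectorSpace_iff_contDiff.2 contDiff_const
  have h4 := h2.comp h3.contMDiffOn (s := e.target) (fun y hy => hy)
  refine h4.congr fun y hy => ?_
  simp only [Function.comp, tangentMapWithin, coordVec]
  rw [mfderivWithin_of_isOpen e.open_target hy]

/-- The components of a metric in a chart are smooth on its target. -/
theorem PseudoRiemannianMetric.contDiffOn_comp (g : PseudoRiemannianMetric n M)
    {e : OpenPartialHomeomorph M (Coord n)}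
    (he : e ∈ IsManifold.maximalAtlas (𝓡 n) ∞ M) (i j : Fin n) :
    ContDiffOn ℝ ∞ (fun y => g.comp e y i j) e.target := by
  rw [← contMDiffOn_iff_contDiffOn]
  have h1 : ContMDiffOn (𝓡 n) (𝓡 n) ∞ e.symm e.target :=
    contMDiffOn_symm_of_mem_maximalAtlas he
  have h2 := g.contMDiff.comp_contMDiffOn h1
  have h3 := ContMDiffOn.clm_bundle_apply₂ (F₃ := ℝ) (E₃ := fun _ : M => ℝ) h2
    (contMDiffOn_coordVec he i) (contMDiffOn_coordVec he j)
  intro y hy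
  have := h3 y hy
  rw [Bundle.contMDiffWithinAt_totalSpace] at this
  exact this.2

theorem PseudoRiemannianMetric.comp_symm (g : PseudoRiemannianMetric n M)
    (e : OpenPartialHomeomorph M (Coord n)) (y : Coord n) (i j : Fin n) :
    g.comp e y i j = g.comp e y j i :=
  g.symm _ _ _

/-- The matrix of the components of a metric in a chart is invertible. -/
theorem PseudoRiemannianMetric.isUnit_det_comp (g : PseudoRiemannianMetric n M)
    {e : OpenPartialHomeomorph M (Coord n)}
    (he : e ∈ IsManifold.maximalAtlas (𝓡 n) ∞ M) {y : Coord n} (hy : y ∈ e.target) :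
    IsUnit (g.comp e y).det := by
  have hd : e.MDifferentiable (𝓡 n) (𝓡 n) :=
    ⟨(contMDiffOn_of_mem_maximalAtlas he).mdifferentiableOn (by simp),
      (contMDiffOn_symm_of_mem_maximalAtlas he).mdifferentiableOn (by simp)⟩
  have hsum : ∀ v : Fin n → ℝ, mfderiv (𝓡 n) (𝓡 n) e.symm y (WithLp.toLp 2 v : Coord n)
      = ∑ i, v i • coordVec e y i := by
    intro v
    have hv : (WithLp.toLp 2 v : Coord n) = ∑ i, v i • EuclideanSpace.single i (1 : ℝ) := by
      ext k
      simp [Finset.sum_apply, Pi.single_apply]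
    rw [hv]
    erw [map_sum]
    refine Finset.sum_congr rfl fun i _ => ?_
    erw [map_smul]
    rfl
  rw [isUnit_iff_ne_zero]
  intro h0
  -- A null row vector `v` would make the tangent vector `∑ v_i ∂_i` orthogonal to every `∂_j`,
  -- which span the tangent space. Nondegeneracy makes that vector zero, and injectivity of the
  -- derivative of `e.symm` then gives `v = 0`.
  obtain ⟨v, hv0, hv⟩ := Matrix.exists_vecMul_eq_zero_iff.mpr h0
  apply hv0
  have hker : mfderiv (𝓡 n) (𝓡 n) e.symm y (WithLp.toLp 2 v : Coord n) = 0 := by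
    apply g.nondegenerate
    intro w
    obtain ⟨w', rfl⟩ := hd.symm.mfderiv_surjective (x := y) hy w
    obtain ⟨u, rfl⟩ : ∃ u : Fin n → ℝ, w' = (WithLp.toLp 2 u : Coord n) := ⟨w'.ofLp, rfl⟩
    rw [hsum, hsum]
    have key : ∀ j, ∑ i, v i * g.comp e y i j = 0 := fun j => congrFun hv j
    simp only [map_sum, map_smul, FunLike.coe_sum, Finset.sum_apply,
      smul_apply, smul_eq_mul]
    refine (Finset.sum_congr rfl fun j _ => ?_).trans (Finset.sum_const_zero (ι := Fin n))
    exact (congrArg (u j * ·) (key j)).trans (mul_zero _)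
  have := hd.symm.mfderiv_injective (x := y) hy (hker.trans (map_zero _).symm)
  exact congrArg WithLp.ofLp this

end Chart

/-! ### Partial derivatives of smooth functions -/

section PartialDerivative

variable {n : ℕ} {U : Set (Coord n)} {f h : Coord n → ℝ} {y : Coord n}

theorem ContDiffOn.differentiableAt_of_isOpen (hf : ContDiffOn ℝ ∞ f U) (hU : IsOpen U)
    (hy : y ∈ U) : DifferentiableAt ℝ f y :=
  (hf.contDiffAt (hU.mem_nhds hy)).differentiableAt (by simp)

theorem ContDiffOn.pd (hf : ContDiffOn ℝ ∞ f U) (hU : IsOpen U) (i : Fin n) :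
    ContDiffOn ℝ ∞ (pd i f) U :=
  (hf.fderiv_of_isOpen (m := ∞) hU (by simp)).clm_apply contDiffOn_const

theorem pd_congr_of_eqOn (hU : IsOpen U) (hy : y ∈ U) (hfh : Set.EqOn f h U) (i : Fin n) :
    pd i f y = pd i h y := by
  unfold pd
  rw [(hfh.eventuallyEq_of_mem (hU.mem_nhds hy)).fderiv_eq]

theorem pd_add (hf : DifferentiableAt ℝ f y) (hh : DifferentiableAt ℝ h y) (i : Fin n) :
    pd i (fun z => f z + h z) y = pd i f y + pd i h y := by
  simp [pd, fderiv_fun_add hf hh]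

theorem pd_sub (hf : DifferentiableAt ℝ f y) (hh : DifferentiableAt ℝ h y) (i : Fin n) :
    pd i (fun z => f z - h z) y = pd i f y - pd i h y := by
  simp [pd, fderiv_fun_sub hf hh]

theorem pd_mul (hf : DifferentiableAt ℝ f y) (hh : DifferentiableAt ℝ h y) (i : Fin n) :
    pd i (fun z => f z * h z) y = pd i f y * h y + f y * pd i h y := by
  simp [pd, fderiv_fun_mul hf hh]
  ring

theorem pd_sum {ι : Type*} (s : Finset ι) {F : ι → Coord n → ℝ}
    (hF : ∀ a ∈ s, DifferentiableAt ℝ (F a) y) (i : Fin n) :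
    pd i (fun z => ∑ a ∈ s, F a z) y = ∑ a ∈ s, pd i (F a) y := by
  simp [pd, fderiv_fun_sum hF]

theorem pd_comm (hf : ContDiffOn ℝ ∞ f U) (hU : IsOpen U) (hy : y ∈ U) (i j : Fin n) :
    pd i (pd j f) y = pd j (pd i f) y := by
  have hc : ContDiffAt ℝ ∞ f y := hf.contDiffAt (hU.mem_nhds hy)
  have h2 : ((2 : ℕ∞) : WithTop ℕ∞) ≤ ∞ := WithTop.coe_le_coe.2 le_top
  have hs : IsSymmSndFDerivAt ℝ f y := hc.isSymmSndFDerivAt (by simpa using h2)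
  have hd : DifferentiableAt ℝ (fderiv ℝ f) y :=
    (hc.fderiv_right (m := 1) (by norm_cast)).differentiableAt (by simp)
  have key : ∀ a b : Fin n, pd a (pd b f) y
      = fderiv ℝ (fderiv ℝ f) y (EuclideanSpace.single a 1) (EuclideanSpace.single b 1) := by
    intro a b
    have : fderiv ℝ (fun z => fderiv ℝ f z (EuclideanSpace.single b 1)) y
        = (fderiv ℝ (fderiv ℝ f) y).flip (EuclideanSpace.single b 1) := by
      rw [fderiv_clm_apply hd (by fun_prop)]
      simp
    change fderiv ℝ (fun z => fderiv ℝ f z (EuclideanSpace.single b 1)) y _ = _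
    rw [this]
    rfl
  rw [key, key]
  exact hs _ _

end PartialDerivative

/-! ### Partial derivatives of matrix-valued functions -/

section MatrixDerivative

variable {n : ℕ} {U : Set (Coord n)} {y : Coord n}

/-- The matrix of the partial derivatives of the entries. -/
noncomputable def matPd (i : Fin n) (F : Coord n → Matrix (Fin n) (Fin n) ℝ) (y : Coord n) :
    Matrix (Fin n) (Fin n) ℝ :=
  Matrix.of fun a b => pd i (fun z => F z a b) y

/-- The entries of a matrix-valued function are smooth on `U`. -/
def MatSmoothOn (F : Coord n → Matrix (Fin n) (Fin n) ℝ) (U : Set (Coord n)) : Prop :=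
  ∀ a b, ContDiffOn ℝ ∞ (fun z => F z a b) U

variable {F H : Coord n → Matrix (Fin n) (Fin n) ℝ}

theorem MatSmoothOn.transpose (hF : MatSmoothOn F U) : MatSmoothOn (fun z => (F z).transpose) U :=
  fun a b => hF b a

theorem MatSmoothOn.add (hF : MatSmoothOn F U) (hH : MatSmoothOn H U) :
    MatSmoothOn (fun z => F z + H z) U :=
  fun a b => (hF a b).add (hH a b)

theorem MatSmoothOn.sub (hF : MatSmoothOn F U) (hH : MatSmoothOn H U) :
    MatSmoothOn (fun z => F z - H z) U :=
  fun a b => (hF a b).sub (hH a b)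

theorem MatSmoothOn.mul (hF : MatSmoothOn F U) (hH : MatSmoothOn H U) :
    MatSmoothOn (fun z => F z * H z) U := by
  intro a b
  simp only [Matrix.mul_apply]
  exact ContDiffOn.sum fun c _ => (hF a c).mul (hH c b)

theorem MatSmoothOn.matPd (hF : MatSmoothOn F U) (hU : IsOpen U) (i : Fin n) :
    MatSmoothOn (matPd i F) U :=
  fun a b => (hF a b).pd hU i

theorem MatSmoothOn.det (hF : MatSmoothOn F U) : ContDiffOn ℝ ∞ (fun z => (F z).det) U := by
  simp only [Matrix.det_apply]
  exact ContDiffOn.sum fun σ _ => (contDiffOn_prod fun i _ => hF _ _).const_smul _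

/-- Cramer's rule: each entry of the inverse is a cofactor divided by the determinant, and both are
polynomial in the entries. -/
theorem MatSmoothOn.inv (hF : MatSmoothOn F U) (hdet : ∀ z ∈ U, IsUnit (F z).det) :
    MatSmoothOn (fun z => (F z)⁻¹) U := by
  intro a b
  simp only [Matrix.inv_def, Matrix.smul_apply, Matrix.adjugate_apply, smul_eq_mul,
    Ring.inverse_eq_inv']
  refine (hF.det.inv fun z hz => (hdet z hz).ne_zero).mul (MatSmoothOn.det fun c d => ?_)
  -- The cofactor is the determinant of `F` with row `b` replaced by a constant basis vector.
  by_cases hc : c = b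
  · subst hc
    simpa using contDiffOn_const
  · simpa [Matrix.updateRow_ne hc] using hF c d

theorem matPd_add (hF : MatSmoothOn F U) (hH : MatSmoothOn H U) (hU : IsOpen U) (hy : y ∈ U)
    (i : Fin n) : matPd i (fun z => F z + H z) y = matPd i F y + matPd i H y := by
  ext a b
  exact pd_add ((hF a b).differentiableAt_of_isOpen hU hy)
    ((hH a b).differentiableAt_of_isOpen hU hy) i

theorem matPd_sub (hF : MatSmoothOn F U) (hH : MatSmoothOn H U) (hU : IsOpen U) (hy : y ∈ U)
    (i : Fin n) : matPd i (fun z => F z - H z) y = matPd i F y - matPd i H y := by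
  ext a b
  exact pd_sub ((hF a b).differentiableAt_of_isOpen hU hy)
    ((hH a b).differentiableAt_of_isOpen hU hy) i

theorem matPd_mul (hF : MatSmoothOn F U) (hH : MatSmoothOn H U) (hU : IsOpen U) (hy : y ∈ U)
    (i : Fin n) : matPd i (fun z => F z * H z) y = matPd i F y * H y + F y * matPd i H y := by
  ext a b
  have hF' := fun c => (hF a c).differentiableAt_of_isOpen hU hy
  have hH' := fun c => (hH c b).differentiableAt_of_isOpen hU hy
  simp only [matPd, Matrix.of_apply, Matrix.mul_apply, Matrix.add_apply]
  rw [pd_sum _ fun c _ => (hF' c).fun_mul (hH' c), ← Finset.sum_add_distrib]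
  exact Finset.sum_congr rfl fun c _ => pd_mul (hF' c) (hH' c) i

theorem matPd_transpose (i : Fin n) :
    matPd i (fun z => (F z).transpose) y = (matPd i F y).transpose :=
  rfl

theorem matPd_comm (hF : MatSmoothOn F U) (hU : IsOpen U) (hy : y ∈ U) (i j : Fin n) :
    matPd i (matPd j F) y = matPd j (matPd i F) y := by
  ext a b
  exact pd_comm (hF a b) hU hy i j

theorem matPd_congr_of_eqOn (hU : IsOpen U) (hy : y ∈ U) (hFH : Set.EqOn F H U) (i : Fin n) :
    matPd i F y = matPd i H y := by
  ext a b
  exact pd_congr_of_eqOn hU hy (fun z hz => by simp only [hFH hz]) i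

end MatrixDerivative

/-! ### The Levi-Civita connection and its curvature in coordinates -/

/-- `G` is the matrix of a smooth pseudo-Riemannian metric on the open set `U`. -/
structure IsMetricOn {n : ℕ} (G : Coord n → Matrix (Fin n) (Fin n) ℝ) (U : Set (Coord n)) :
    Prop where
  isOpen : IsOpen U
  smooth : MatSmoothOn G U
  symm : ∀ z i j, G z i j = G z j i
  isUnit_det : ∀ z ∈ U, IsUnit (G z).det

section Curvature

variable {n : ℕ} {U : Set (Coord n)} {y : Coord n} {G : Coord n → Matrix (Fin n) (Fin n) ℝ}

/-- The connection matrix `(Γ_i)^m_l = Γ^m_{il}`. -/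
noncomputable def connMat (G : Coord n → Matrix (Fin n) (Fin n) ℝ) (i : Fin n) (y : Coord n) :
    Matrix (Fin n) (Fin n) ℝ :=
  Matrix.of fun m l => christoffel G m i l y

/-- The curvature matrix `(R_{jk})^m_l = R_{jkl}{}^m`. -/
noncomputable def curvMat (G : Coord n → Matrix (Fin n) (Fin n) ℝ) (j k : Fin n) (y : Coord n) :
    Matrix (Fin n) (Fin n) ℝ :=
  Matrix.of fun m l => riemann G j k l m y

/-- The Riemann tensor with all indices down, `R_{jklm} = R_{jkl}{}^p g_{pm}`. -/
noncomputable def riemannLow (G : Coord n → Matrix (Fin n) (Fin n) ℝ) (j k l m : Fin n)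
    (y : Coord n) : ℝ :=
  ∑ p, riemann G j k l p y * G y p m

/-- The sign is opposite to the usual curvature `∂_j Γ_k - ∂_k Γ_j + [Γ_j, Γ_k]` on vectors, because
the convention is fixed by the action on covectors. -/
theorem curvMat_eq (G : Coord n → Matrix (Fin n) (Fin n) ℝ) (j k : Fin n) (y : Coord n) :
    curvMat G j k y = matPd k (connMat G j) y - matPd j (connMat G k) y
      + (connMat G k y * connMat G j y - connMat G j y * connMat G k y) := by
  ext m l
  simp only [curvMat, matPd, connMat, riemann, Matrix.of_apply, Matrix.add_apply,
    Matrix.sub_apply, Matrix.mul_apply, Finset.sum_sub_distrib]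

theorem curvMat_antisymm (G : Coord n → Matrix (Fin n) (Fin n) ℝ) (j k : Fin n) (y : Coord n) :
    curvMat G k j y = -curvMat G j k y := by
  rw [curvMat_eq, curvMat_eq]
  abel

namespace IsMetricOn

theorem mul_inv (hG : IsMetricOn G U) (hy : y ∈ U) : G y * (G y)⁻¹ = 1 :=
  Matrix.mul_nonsing_inv _ (hG.isUnit_det y hy)

theorem inv_mul (hG : IsMetricOn G U) (hy : y ∈ U) : (G y)⁻¹ * G y = 1 :=
  Matrix.nonsing_inv_mul _ (hG.isUnit_det y hy)

theorem christoffel_symm (hG : IsMetricOn G U) (k i j : Fin n) (y : Coord n) :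
    christoffel G k i j y = christoffel G k j i y := by
  -- Symmetry of `G` holds at every point and not only on `U`, so the component functions themselves
  -- coincide and may be exchanged under `pd`.
  have h : ∀ i j, (fun z => G z i j) = fun z => G z j i := fun i j => funext fun z => hG.symm z i j
  unfold christoffel
  congr 1
  refine Finset.sum_congr rfl fun l _ => ?_
  rw [h i j]
  ring

theorem smooth_connMat (hG : IsMetricOn G U) (i : Fin n) : MatSmoothOn (connMat G i) U := by
  intro m l
  simp only [connMat, christoffel, Matrix.of_apply]
  refine contDiffOn_const.mul (ContDiffOn.sum fun p _ => ?_)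
  have hd := fun i j k => (hG.smooth i j).pd hG.isOpen k
  exact (hG.smooth.inv hG.isUnit_det m p).mul (((hd _ _ _).add (hd _ _ _)).sub (hd _ _ _))

theorem smooth_curvMat (hG : IsMetricOn G U) (j k : Fin n) : MatSmoothOn (curvMat G j k) U := by
  have h := fun i => hG.smooth_connMat i
  have : curvMat G j k = fun y => matPd k (connMat G j) y - matPd j (connMat G k) y
      + (connMat G k y * connMat G j y - connMat G j y * connMat G k y) :=
    funext fun y => curvMat_eq G j k y
  rw [this]
  exact (((h j).matPd hG.isOpen k).sub ((h k).matPd hG.isOpen j)).add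
    (((h k).mul (h j)).sub ((h j).mul (h k)))

/-- The Christoffel symbols of the first kind. -/
theorem mul_connMat_apply (hG : IsMetricOn G U) (hy : y ∈ U) (k l m : Fin n) :
    (G y * connMat G k y) l m = (1 / 2) * (pd k (fun z => G z m l) y + pd m (fun z => G z k l) y
      - pd l (fun z => G z k m) y) := by
  set v : Fin n → ℝ := fun l => pd k (fun z => G z m l) y + pd m (fun z => G z k l) y
      - pd l (fun z => G z k m) y with hv
  have h1 : (fun p => connMat G k y p m) = (1 / 2 : ℝ) • (G y)⁻¹.mulVec v := by
    funext p
    simp [connMat, christoffel, Matrix.mulVec, dotProduct, hv]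
  have h2 : (G y * connMat G k y) l m = (G y).mulVec (fun p => connMat G k y p m) l := rfl
  rw [h2, h1, Matrix.mulVec_smul, Matrix.mulVec_mulVec, hG.mul_inv hy, Matrix.one_mulVec]
  rfl

/-- The Levi-Civita connection is metric. -/
theorem matPd_metric (hG : IsMetricOn G U) (hy : y ∈ U) (k : Fin n) :
    matPd k G y = (connMat G k y).transpose * G y + G y * connMat G k y := by
  have hs : (G y).transpose = G y := Matrix.ext fun i j => hG.symm y j i
  have ht : (connMat G k y).transpose * G y = (G y * connMat G k y).transpose := by
    rw [Matrix.transpose_mul, hs]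
  ext l m
  have h : ∀ i j, (fun z => G z i j) = fun z => G z j i := fun i j => funext fun z => hG.symm z i j
  rw [ht, Matrix.add_apply, Matrix.transpose_apply, hG.mul_connMat_apply hy,
    hG.mul_connMat_apply hy, h m l]
  simp only [matPd, Matrix.of_apply]
  ring

/-- The second Bianchi identity for the curvature matrices. -/
theorem bianchi_curvMat (hG : IsMetricOn G U) (hy : y ∈ U) (i j k : Fin n) :
    (matPd i (curvMat G j k) y + connMat G i y * curvMat G j k y
        - curvMat G j k y * connMat G i y)
      + (matPd j (curvMat G k i) y + connMat G j y * curvMat G k i y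
        - curvMat G k i y * connMat G j y)
      + (matPd k (curvMat G i j) y + connMat G k y * curvMat G i j y
        - curvMat G i j y * connMat G k y) = 0 := by
  have h := fun i => hG.smooth_connMat i
  have hd := fun i j => (h i).matPd hG.isOpen j
  have hU := hG.isOpen
  have hpd : ∀ i j k, matPd i (curvMat G j k) y
      = matPd i (matPd k (connMat G j)) y - matPd i (matPd j (connMat G k)) y
        + ((matPd i (connMat G k) y * connMat G j y + connMat G k y * matPd i (connMat G j) y)
          - (matPd i (connMat G j) y * connMat G k y + connMat G j y * matPd i (connMat G k) y)) := by
    intro i j k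
    rw [matPd_congr_of_eqOn hU hy (fun z _ => curvMat_eq G j k z),
      matPd_add ((hd j k).sub (hd k j)) (((h k).mul (h j)).sub ((h j).mul (h k))) hU hy,
      matPd_sub (hd j k) (hd k j) hU hy,
      matPd_sub ((h k).mul (h j)) ((h j).mul (h k)) hU hy,
      matPd_mul (h k) (h j) hU hy, matPd_mul (h j) (h k) hU hy]
  -- Once mixed second derivatives are identified, what remains is an identity in noncommuting `Γ`
  -- and `∂Γ`; its cubic part is the Jacobi identity.
  rw [hpd, hpd, hpd, curvMat_eq, curvMat_eq, curvMat_eq, matPd_comm (h i) hU hy j k,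
    matPd_comm (h j) hU hy i k, matPd_comm (h k) hU hy i j]
  noncomm_ring

/-- The curvature matrices are skew with respect to the metric. -/
theorem metric_mul_curvMat (hG : IsMetricOn G U) (hy : y ∈ U) (j k : Fin n) :
    (curvMat G j k y).transpose * G y + G y * curvMat G j k y = 0 := by
  have h := fun i => hG.smooth_connMat i
  have hU := hG.isOpen
  have hpd : ∀ j k, matPd j (matPd k G) y
      = ((matPd j (connMat G k) y).transpose * G y + (connMat G k y).transpose * matPd j G y)
        + (matPd j G y * connMat G k y + G y * matPd j (connMat G k) y) := by
    intro j k
    rw [matPd_congr_of_eqOn hU hy (fun z hz => hG.matPd_metric hz k),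
      matPd_add ((h k).transpose.mul hG.smooth) (hG.smooth.mul (h k)) hU hy,
      matPd_mul (h k).transpose hG.smooth hU hy, matPd_mul hG.smooth (h k) hU hy,
      matPd_transpose]
  -- Skewness is the integrability condition of `∂_k G = Γ_kᵀ G + G Γ_k`: the two orders of
  -- differentiating `G` agree.
  have hc := matPd_comm hG.smooth hU hy j k
  rw [hpd, hpd, hG.matPd_metric hy, hG.matPd_metric hy, ← sub_eq_zero] at hc
  rw [curvMat_eq, ← neg_eq_zero, ← hc]
  simp only [Matrix.transpose_add, Matrix.transpose_sub, Matrix.transpose_mul]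
  noncomm_ring

theorem riemannLow_eq (hG : IsMetricOn G U) (j k l m : Fin n) (y : Coord n) :
    riemannLow G j k l m y = (G y * curvMat G j k y) m l := by
  simp only [riemannLow, Matrix.mul_apply, curvMat, Matrix.of_apply]
  exact Finset.sum_congr rfl fun p _ => by rw [hG.symm y p m, mul_comm]

theorem riemannLow_antisymm_left (hG : IsMetricOn G U) (j k l m : Fin n) (y : Coord n) :
    riemannLow G k j l m y = -riemannLow G j k l m y := by
  rw [hG.riemannLow_eq, hG.riemannLow_eq, curvMat_antisymm, mul_neg, Matrix.neg_apply]

theorem riemannLow_antisymm_right (hG : IsMetricOn G U) (hy : y ∈ U) (j k l m : Fin n) :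
    riemannLow G j k m l y = -riemannLow G j k l m y := by
  have hs : (G y).transpose = G y := Matrix.ext fun i j => hG.symm y j i
  have h := hG.metric_mul_curvMat hy j k
  have ht : (curvMat G j k y).transpose * G y = (G y * curvMat G j k y).transpose := by
    rw [Matrix.transpose_mul, hs]
  have := congrFun (congrFun (ht ▸ h) l) m
  rw [Matrix.add_apply, Matrix.transpose_apply, Matrix.zero_apply] at this
  rw [hG.riemannLow_eq, hG.riemannLow_eq]
  linarith

/-- The first Bianchi identity. -/
theorem riemann_cyclic (hG : IsMetricOn G U) (j k l m : Fin n) (y : Coord n) :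
    riemann G j k l m y + riemann G k l j m y + riemann G l j k m y = 0 := by
  have h : ∀ m i j, christoffel G m i j = christoffel G m j i :=
    fun m i j => funext fun z => hG.christoffel_symm m i j z
  simp only [riemann, Finset.sum_sub_distrib]
  rw [h m k l, h m l j, h m k j]
  have hs : ∀ a b c, ∑ p, christoffel G m a p y * christoffel G p b c y
      = ∑ p, christoffel G m a p y * christoffel G p c b y :=
    fun a b c => Finset.sum_congr rfl fun p _ => by rw [h p b c]
  rw [hs k j l, hs l k j, hs j l k]
  ring

theorem riemannLow_cyclic (hG : IsMetricOn G U) (j k l m : Fin n) (y : Coord n) :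
    riemannLow G j k l m y + riemannLow G k l j m y + riemannLow G l j k m y = 0 := by
  simp only [riemannLow, ← Finset.sum_add_distrib, ← add_mul, hG.riemann_cyclic, zero_mul,
    Finset.sum_const_zero]

theorem smooth_riemannLow (hG : IsMetricOn G U) (j k l m : Fin n) :
    ContDiffOn ℝ ∞ (riemannLow G j k l m) U := by
  refine ((hG.smooth.mul (hG.smooth_curvMat j k)) m l).congr fun z _ => ?_
  exact hG.riemannLow_eq j k l m z

/-- Metric compatibility cancels the correction for the lowered index `m`. The corrections for the
two endomorphism indices form the commutator `[Γ_i, R_{jk}]` of the matrix Bianchi identity; only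
those for `j` and `k` stay outside it. -/
theorem covDeriv4_riemannLow (hG : IsMetricOn G U) (hy : y ∈ U) (i j k l m : Fin n) :
    covDeriv4 G (riemannLow G) i j k l m y
      = (G y * (matPd i (curvMat G j k) y + connMat G i y * curvMat G j k y
          - curvMat G j k y * connMat G i y)) m l
        - ∑ p, christoffel G p i j y * riemannLow G p k l m y
        - ∑ p, christoffel G p i k y * riemannLow G j p l m y := by
  have h1 : pd i (riemannLow G j k l m) y = matPd i (fun z => G z * curvMat G j k z) y m l :=
    pd_congr_of_eqOn hG.isOpen hy (fun z _ => hG.riemannLow_eq j k l m z) i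
  rw [matPd_mul hG.smooth (hG.smooth_curvMat j k) hG.isOpen hy, hG.matPd_metric hy] at h1
  have h2 : ∑ p, christoffel G p i l y * riemannLow G j k p m y
      = (G y * curvMat G j k y * connMat G i y) m l := by
    rw [Matrix.mul_apply]
    refine Finset.sum_congr rfl fun p _ => ?_
    rw [hG.riemannLow_eq, mul_comm]
    rfl
  have h3 : ∑ p, christoffel G p i m y * riemannLow G j k l p y
      = ((connMat G i y).transpose * (G y * curvMat G j k y)) m l := by
    rw [Matrix.mul_apply]
    refine Finset.sum_congr rfl fun p _ => ?_
    rw [hG.riemannLow_eq]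
    rfl
  have h4 : G y * (matPd i (curvMat G j k) y + connMat G i y * curvMat G j k y
          - curvMat G j k y * connMat G i y)
      = ((connMat G i y).transpose * G y + G y * connMat G i y) * curvMat G j k y
          + G y * matPd i (curvMat G j k) y - G y * curvMat G j k y * connMat G i y
        - (connMat G i y).transpose * (G y * curvMat G j k y) := by
    noncomm_ring
  rw [h4, Matrix.sub_apply, Matrix.sub_apply, ← h1, ← h2, ← h3]
  simp only [covDeriv4, Finset.sum_add_distrib]
  ring

/-- The second Bianchi identity. -/
theorem covDeriv4_riemannLow_cyclic (hG : IsMetricOn G U) (hy : y ∈ U) (i j k l m : Fin n) :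
    covDeriv4 G (riemannLow G) i j k l m y + covDeriv4 G (riemannLow G) j k i l m y
      + covDeriv4 G (riemannLow G) k i j l m y = 0 := by
  have h := congrArg (fun X => (G y * X) m l) (hG.bianchi_curvMat hy i j k)
  simp only [mul_add, Matrix.add_apply, mul_zero, Matrix.zero_apply] at h
  -- By symmetry of `Γ` and skewness of the curvature, the corrections for the form indices cancel
  -- in pairs over the cyclic sum.
  have hs : ∀ a b c, ∑ p, christoffel G p a b y * riemannLow G c p l m y
      = -∑ p, christoffel G p b a y * riemannLow G p c l m y := by
    intro a b c
    rw [← Finset.sum_neg_distrib]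
    refine Finset.sum_congr rfl fun p _ => ?_
    rw [hG.christoffel_symm p a b, hG.riemannLow_antisymm_left p c]
    ring
  rw [hG.covDeriv4_riemannLow hy, hG.covDeriv4_riemannLow hy, hG.covDeriv4_riemannLow hy,
    hs i k j, hs j i k, hs k j i]
  linarith

end IsMetricOn

end Curvature

/-! ### Tensors with the symmetries of a curvature tensor -/

/-- The algebraic symmetries of a curvature tensor. -/
structure IsCurvatureLike {n : ℕ} (C : Fin n → Fin n → Fin n → Fin n → ℝ) : Prop where
  antisymm_left : ∀ j k l m, C k j l m = -C j k l m
  antisymm_right : ∀ j k l m, C j k m l = -C j k l m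
  cyclic : ∀ j k l m, C j k l m + C k l j m + C l j k m = 0

/-- Of the four cyclic identities on `j, k, l, m`, the first two minus the last two leave `2
(C_{jklm} - C_{lmjk}) = 0` once skewness is used. -/
theorem IsCurvatureLike.pair_symm {n : ℕ} {C : Fin n → Fin n → Fin n → Fin n → ℝ}
    (hC : IsCurvatureLike C) (j k l m : Fin n) : C j k l m = C l m j k := by
  have c1 := hC.cyclic j k l m
  have c2 := hC.cyclic k l m j
  have c3 := hC.cyclic l m j k
  have c4 := hC.cyclic m j k l
  have a1 := hC.antisymm_right k l j m
  have a2 := hC.antisymm_right l m k j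
  have a3 := hC.antisymm_right m j l k
  have a4 := hC.antisymm_right j k m l
  have b1 := hC.antisymm_left j l k m
  have b2 := hC.antisymm_right j l m k
  have b3 := hC.antisymm_left k m l j
  have b4 := hC.antisymm_right m k l j
  have b5 := hC.antisymm_right k m j l
  linarith

theorem IsCurvatureLike.add {n : ℕ} {C C' : Fin n → Fin n → Fin n → Fin n → ℝ}
    (hC : IsCurvatureLike C) (hC' : IsCurvatureLike C') :
    IsCurvatureLike (fun j k l m => C j k l m + C' j k l m) where
  antisymm_left j k l m := by rw [hC.antisymm_left, hC'.antisymm_left]; ring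
  antisymm_right j k l m := by rw [hC.antisymm_right, hC'.antisymm_right]; ring
  cyclic j k l m := by linarith [hC.cyclic j k l m, hC'.cyclic j k l m]

/-! ### Covariant derivatives -/

section CovariantDerivative

variable {n : ℕ} {U : Set (Coord n)} {y : Coord n} {G : Coord n → Matrix (Fin n) (Fin n) ℝ}
  {T T' : Fin n → Fin n → Fin n → Fin n → Coord n → ℝ}

theorem covDeriv4_congr_of_eqOn (hU : IsOpen U) (hy : y ∈ U)
    (h : ∀ j k l m, Set.EqOn (T j k l m) (T' j k l m) U) (i j k l m : Fin n) :
    covDeriv4 G T i j k l m y = covDeriv4 G T' i j k l m y := by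
  simp only [covDeriv4, pd_congr_of_eqOn hU hy (h j k l m) i, (h _ _ _ _ hy)]

theorem covDeriv4_add (hT : ∀ j k l m, DifferentiableAt ℝ (T j k l m) y)
    (hT' : ∀ j k l m, DifferentiableAt ℝ (T' j k l m) y) (i j k l m : Fin n) :
    covDeriv4 G (fun j k l m z => T j k l m z + T' j k l m z) i j k l m y
      = covDeriv4 G T i j k l m y + covDeriv4 G T' i j k l m y := by
  simp only [covDeriv4, pd_add (hT j k l m) (hT' j k l m), mul_add, Finset.sum_add_distrib]
  ring

theorem covDeriv4_sub (hT : ∀ j k l m, DifferentiableAt ℝ (T j k l m) y)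
    (hT' : ∀ j k l m, DifferentiableAt ℝ (T' j k l m) y) (i j k l m : Fin n) :
    covDeriv4 G (fun j k l m z => T j k l m z - T' j k l m z) i j k l m y
      = covDeriv4 G T i j k l m y - covDeriv4 G T' i j k l m y := by
  simp only [covDeriv4, pd_sub (hT j k l m) (hT' j k l m), mul_sub, Finset.sum_add_distrib,
    Finset.sum_sub_distrib]
  ring

/-- With its companion below, this reduces the four metric–Schouten products in the Weyl tensor to a
single one. -/
theorem covDeriv4_swap_left (i j k l m : Fin n) :
    covDeriv4 G (fun j k l m => T k j l m) i j k l m y = covDeriv4 G T i k j l m y := by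
  simp only [covDeriv4, Finset.sum_add_distrib]
  ring

theorem covDeriv4_swap_right (i j k l m : Fin n) :
    covDeriv4 G (fun j k l m => T j k m l) i j k l m y = covDeriv4 G T i j k m l y := by
  simp only [covDeriv4, Finset.sum_add_distrib]
  ring

/-- The covariant derivative `∇_i S_{kl}` of a covariant tensor field of rank two. -/
noncomputable def covDeriv2 (G : Coord n → Matrix (Fin n) (Fin n) ℝ)
    (S : Fin n → Fin n → Coord n → ℝ) (i k l : Fin n) (y : Coord n) : ℝ :=
  pd i (S k l) y - ∑ p, (christoffel G p i k y * S p l y + christoffel G p i l y * S k p y)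

theorem IsMetricOn.pd_metric (hG : IsMetricOn G U) (hy : y ∈ U) (i j m : Fin n) :
    pd i (fun z => G z j m) y
      = ∑ p, christoffel G p i j y * G y p m + ∑ p, christoffel G p i m y * G y j p := by
  have h := congrFun (congrFun (hG.matPd_metric hy i) j) m
  simp only [matPd, Matrix.of_apply, Matrix.add_apply, Matrix.mul_apply, connMat,
    Matrix.transpose_apply] at h
  rw [h]
  congr 1
  exact Finset.sum_congr rfl fun p _ => mul_comm _ _

/-- The metric is parallel, so it passes through the covariant derivative. -/
theorem IsMetricOn.covDeriv4_metric_mul (hG : IsMetricOn G U) (hy : y ∈ U)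
    {S : Fin n → Fin n → Coord n → ℝ} (hS : ∀ k l, DifferentiableAt ℝ (S k l) y)
    (i j k l m : Fin n) :
    covDeriv4 G (fun j k l m z => G z j m * S k l z) i j k l m y
      = G y j m * covDeriv2 G S i k l y := by
  have hg := (hG.smooth j m).differentiableAt_of_isOpen hG.isOpen hy
  have h1 : ∑ p, christoffel G p i j y * (G y p m * S k l y)
      = (∑ p, christoffel G p i j y * G y p m) * S k l y := by
    rw [Finset.sum_mul]; exact Finset.sum_congr rfl fun p _ => by ring
  have h2 : ∑ p, christoffel G p i k y * (G y j m * S p l y)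
      = G y j m * ∑ p, christoffel G p i k y * S p l y := by
    rw [Finset.mul_sum]; exact Finset.sum_congr rfl fun p _ => by ring
  have h3 : ∑ p, christoffel G p i l y * (G y j m * S k p y)
      = G y j m * ∑ p, christoffel G p i l y * S k p y := by
    rw [Finset.mul_sum]; exact Finset.sum_congr rfl fun p _ => by ring
  have h4 : ∑ p, christoffel G p i m y * (G y j p * S k l y)
      = (∑ p, christoffel G p i m y * G y j p) * S k l y := by
    rw [Finset.sum_mul]; exact Finset.sum_congr rfl fun p _ => by ring
  simp only [covDeriv4, covDeriv2, Finset.sum_add_distrib, h1, h2, h3, h4]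
  rw [pd_mul hg (hS k l), hG.pd_metric hy]
  ring

end CovariantDerivative

/-! ### The Weyl tensor -/

section Weyl

variable {n : ℕ} {U : Set (Coord n)} {y : Coord n} {G : Coord n → Matrix (Fin n) (Fin n) ℝ}

/-- The Schouten tensor. -/
noncomputable def schouten (G : Coord n → Matrix (Fin n) (Fin n) ℝ) (k l : Fin n)
    (y : Coord n) : ℝ :=
  1 / ((n : ℝ) - 2) * (ricci G k l y - scalarCurv G y / (2 * ((n : ℝ) - 1)) * G y k l)

theorem sum_kron_mul (j : Fin n) (f : Fin n → ℝ) : ∑ p, kron j p * f p = f j := by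
  simp [kron]

theorem inv_symm_of_symm {g : Matrix (Fin n) (Fin n) ℝ} (hg : ∀ i j, g i j = g j i)
    (i j : Fin n) : g⁻¹ i j = g⁻¹ j i := by
  have hs : g.transpose = g := Matrix.ext fun i j => hg j i
  conv_lhs => rw [← hs, ← Matrix.transpose_nonsing_inv]
  rfl

namespace IsMetricOn

theorem sum_ricciUp_mul (hG : IsMetricOn G U) (hy : y ∈ U) (k m : Fin n) :
    ∑ p, ricciUp G k p y * G y p m = ricci G k m y := by
  have h : (Matrix.of fun i j => ricci G i j y) * (G y)⁻¹ * G y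
      = Matrix.of fun i j => ricci G i j y := by
    rw [Matrix.mul_assoc, hG.inv_mul hy, Matrix.mul_one]
  exact congrFun (congrFun h k) m

/-- Each product `g g` arises twice on the right, which is why the Schouten tensor carries half of
the scalar curvature coefficient. -/
theorem weyl_eq (hG : IsMetricOn G U) (hy : y ∈ U) (j k l m : Fin n) :
    weyl G j k l m y = riemannLow G j k l m y + (G y j m * schouten G k l y
      - G y k m * schouten G j l y + G y k l * schouten G j m y
      - G y j l * schouten G k m y) := by
  have e1 : ∀ j (c : ℝ), ∑ p, kron j p * c * G y p m = G y j m * c := by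
    intro j c
    rw [← sum_kron_mul j (fun p => G y p m * c)]
    exact Finset.sum_congr rfl fun p _ => by ring
  have e2 : ∀ j (c : ℝ), ∑ p, ricciUp G j p y * c * G y p m = ricci G j m y * c := by
    intro j c
    rw [← hG.sum_ricciUp_mul hy, Finset.sum_mul]
    exact Finset.sum_congr rfl fun p _ => by ring
  have : weyl G j k l m y = riemannLow G j k l m y
      + 1 / ((n : ℝ) - 2) * (∑ p, kron j p * ricci G k l y * G y p m
        - ∑ p, kron k p * ricci G j l y * G y p m + ∑ p, ricciUp G j p y * G y k l * G y p m
        - ∑ p, ricciUp G k p y * G y j l * G y p m)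
      - scalarCurv G y * ((∑ p, kron j p * G y k l * G y p m - ∑ p, kron k p * G y j l * G y p m)
      / (((n : ℝ) - 1) * ((n : ℝ) - 2))) := by
    simp only [weyl, weylUp, riemannLow, Finset.mul_sum, Finset.sum_div, ← Finset.sum_add_distrib,
      ← Finset.sum_sub_distrib]
    exact Finset.sum_congr rfl fun p _ => by ring
  rw [this, e1, e1, e1, e1, e2, e2]
  -- With inverses kept as atoms, no condition `n ≠ 1, 2` is needed.
  simp only [schouten, div_eq_mul_inv, _root_.mul_inv]
  ring

theorem riemannLow_isCurvatureLike (hG : IsMetricOn G U) (hy : y ∈ U) :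
    IsCurvatureLike (fun j k l m => riemannLow G j k l m y) where
  antisymm_left j k l m := hG.riemannLow_antisymm_left j k l m y
  antisymm_right j k l m := hG.riemannLow_antisymm_right hy j k l m
  cyclic j k l m := hG.riemannLow_cyclic j k l m y

/-- Ricci as a trace of the lowered curvature, so that pair symmetry can yield its symmetry. -/
theorem ricci_eq (hG : IsMetricOn G U) (hy : y ∈ U) (k l : Fin n) :
    ricci G k l y = -∑ m, ∑ p, (G y)⁻¹ p m * riemannLow G m k l p y := by
  unfold ricci
  congr 1
  refine Finset.sum_congr rfl fun m _ => ?_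
  have h : (curvMat G m k y).transpose * G y * (G y)⁻¹ = (curvMat G m k y).transpose := by
    rw [Matrix.mul_assoc, hG.mul_inv hy, Matrix.mul_one]
  have h' := congrFun (congrFun h l) m
  rw [Matrix.mul_apply] at h'
  exact h'.symm.trans (Finset.sum_congr rfl fun p _ => mul_comm _ _)

theorem ricci_symm (hG : IsMetricOn G U) (hy : y ∈ U) (k l : Fin n) :
    ricci G k l y = ricci G l k y := by
  have hR := hG.riemannLow_isCurvatureLike hy
  rw [hG.ricci_eq hy, hG.ricci_eq hy, Finset.sum_comm]
  congr 1
  refine Finset.sum_congr rfl fun p _ => Finset.sum_congr rfl fun m _ => ?_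
  have h1 : riemannLow G m k l p y = riemannLow G l p m k y := hR.pair_symm m k l p
  rw [inv_symm_of_symm (hG.symm y) p m, h1, hG.riemannLow_antisymm_left p l m k,
    hG.riemannLow_antisymm_right hy p l k m, neg_neg]

theorem schouten_symm (hG : IsMetricOn G U) (hy : y ∈ U) (k l : Fin n) :
    schouten G k l y = schouten G l k y := by
  simp only [schouten, hG.ricci_symm hy k l, hG.symm y k l]

theorem weyl_isCurvatureLike (hG : IsMetricOn G U) (hy : y ∈ U) :
    IsCurvatureLike (fun j k l m => weyl G j k l m y) := by
  have hP : IsCurvatureLike (fun j k l m => G y j m * schouten G k l y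
      - G y k m * schouten G j l y + G y k l * schouten G j m y
      - G y j l * schouten G k m y) :=
    { antisymm_left := fun j k l m => by ring
      antisymm_right := fun j k l m => by ring
      cyclic := fun j k l m => by
        rw [hG.schouten_symm hy k j, hG.schouten_symm hy l j, hG.schouten_symm hy l k,
          hG.symm y k j, hG.symm y l j, hG.symm y l k]
        ring }
  simp only [hG.weyl_eq hy]
  exact (hG.riemannLow_isCurvatureLike hy).add hP

theorem sum_weylUp_eq_zero (hG : IsMetricOn G U) (hy : y ∈ U) (hn : 5 ≤ n) (k l : Fin n) :
    ∑ j, weylUp G j k l j y = 0 := by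
  have hn' : (5 : ℝ) ≤ n := by exact_mod_cast hn
  have e1 : ∀ c : ℝ, ∑ j : Fin n, kron j j * c = n * c := by
    intro c
    simp [kron]
  have e3 : ∑ j, ricciUp G j j y * G y k l = scalarCurv G y * G y k l := by
    rw [← Finset.sum_mul]
    congr 1
    refine Finset.sum_congr rfl fun i _ => Finset.sum_congr rfl fun j _ => ?_
    rw [inv_symm_of_symm (hG.symm y) j i, mul_comm]
  have : ∑ j, weylUp G j k l j y = ∑ j, riemann G j k l j y
      + 1 / ((n : ℝ) - 2) * (∑ j : Fin n, kron j j * ricci G k l y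
        - ∑ j, kron k j * ricci G j l y + ∑ j, ricciUp G j j y * G y k l
        - ∑ j, ricciUp G k j y * G y j l)
      - scalarCurv G y * ((∑ j : Fin n, kron j j * G y k l - ∑ j, kron k j * G y j l)
      / (((n : ℝ) - 1) * ((n : ℝ) - 2))) := by
    simp only [weylUp, Finset.mul_sum, Finset.sum_div, ← Finset.sum_add_distrib,
      ← Finset.sum_sub_distrib]
  have hr : ∑ j, riemann G j k l j y = -ricci G k l y := by simp [ricci]
  rw [this, e1, e1, e3, sum_kron_mul, sum_kron_mul, hG.sum_ricciUp_mul hy, hr]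
  have h1 : (n : ℝ) - 1 ≠ 0 := by linarith
  have h2 : (n : ℝ) - 2 ≠ 0 := by linarith
  field_simp
  ring

/-- The Weyl tensor is traceless. -/
theorem trace2_weyl (hG : IsMetricOn G U) (hy : y ∈ U) (hn : 5 ≤ n) (k l : Fin n) :
    trace2 (G y) (fun j m => weyl G j k l m y) = 0 := by
  rw [← hG.sum_weylUp_eq_zero hy hn k l]
  refine Finset.sum_congr rfl fun j _ => ?_
  have h : (Matrix.of fun a b => weylUp G a k l b y) * G y * (G y)⁻¹
      = Matrix.of fun a b => weylUp G a k l b y := by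
    rw [Matrix.mul_assoc, hG.mul_inv hy, Matrix.mul_one]
  have h' := congrFun (congrFun h j) j
  rw [Matrix.mul_apply] at h'
  refine Eq.trans (Finset.sum_congr rfl fun p _ => ?_) h'
  rw [inv_symm_of_symm (hG.symm y) j p, mul_comm]
  rfl

theorem smooth_riemann (hG : IsMetricOn G U) (j k l m : Fin n) :
    ContDiffOn ℝ ∞ (riemann G j k l m) U :=
  hG.smooth_curvMat j k m l

theorem smooth_ricci (hG : IsMetricOn G U) (k l : Fin n) : ContDiffOn ℝ ∞ (ricci G k l) U :=
  (ContDiffOn.sum fun m _ => hG.smooth_riemann m k l m).neg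

theorem smooth_schouten (hG : IsMetricOn G U) (k l : Fin n) :
    ContDiffOn ℝ ∞ (schouten G k l) U := by
  have hs : ContDiffOn ℝ ∞ (scalarCurv G) U :=
    ContDiffOn.sum fun i _ => ContDiffOn.sum fun j _ =>
      (hG.smooth.inv hG.isUnit_det i j).mul (hG.smooth_ricci i j)
  exact contDiffOn_const.mul ((hG.smooth_ricci k l).sub ((hs.div_const _).mul (hG.smooth k l)))

theorem covDeriv4_weyl (hG : IsMetricOn G U) (hy : y ∈ U) (i j k l m : Fin n) :
    covDeriv4 G (weyl G) i j k l m y = covDeriv4 G (riemannLow G) i j k l m y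
      + (G y j m * covDeriv2 G (schouten G) i k l y - G y k m * covDeriv2 G (schouten G) i j l y
        + G y k l * covDeriv2 G (schouten G) i j m y
        - G y j l * covDeriv2 G (schouten G) i k m y) := by
  have hS := fun k l => (hG.smooth_schouten k l).differentiableAt_of_isOpen hG.isOpen hy
  have hR := fun j k l m => (hG.smooth_riemannLow j k l m).differentiableAt_of_isOpen hG.isOpen hy
  have hg := fun j k => (hG.smooth j k).differentiableAt_of_isOpen hG.isOpen hy
  have hP := hG.covDeriv4_metric_mul hy hS
  set P : Fin n → Fin n → Fin n → Fin n → Coord n → ℝ :=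
    fun j k l m z => G z j m * schouten G k l z with hPdef
  have hPd : ∀ j k l m, DifferentiableAt ℝ (P j k l m) y :=
    fun j k l m => (hg j m).mul (hS k l)
  rw [covDeriv4_congr_of_eqOn hG.isOpen hy (T' := fun j k l m z => riemannLow G j k l m z
      + (P j k l m z - P k j l m z + P k j m l z - P j k m l z))
      (fun j k l m z hz => hG.weyl_eq hz j k l m),
    covDeriv4_add hR fun j k l m => (((hPd _ _ _ _).fun_sub (hPd _ _ _ _)).fun_add
      (hPd _ _ _ _)).fun_sub (hPd _ _ _ _),
    covDeriv4_sub (fun j k l m => ((hPd _ _ _ _).fun_sub (hPd _ _ _ _)).fun_add (hPd _ _ _ _))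
      fun j k l m => hPd _ _ _ _,
    covDeriv4_add (fun j k l m => (hPd _ _ _ _).fun_sub (hPd _ _ _ _)) fun j k l m => hPd _ _ _ _,
    covDeriv4_sub (fun j k l m => hPd _ _ _ _) fun j k l m => hPd _ _ _ _]
  have s1 := covDeriv4_swap_left (G := G) (T := P) (y := y) i j k l m
  have s2 := covDeriv4_swap_right (G := G) (T := P) (y := y) i j k l m
  have s3 := covDeriv4_swap_left (G := G) (T := fun j k l m => P j k m l) (y := y) i j k l m
  have s4 := covDeriv4_swap_right (G := G) (T := P) (y := y) i k j l m
  rw [hP] at s1 s2 s4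
  rw [s4] at s3
  rw [hP]
  exact congrArg₂ _ rfl (congrArg₂ _ (congrArg₂ _ (congrArg₂ _ rfl s1) s3) s2)

/-- The Bianchi-type identity of the Weyl tensor: the cyclic sum of `∇_i C_{jklm}` is a
combination of the metric and of the Cotton tensor. -/
theorem covDeriv4_weyl_cyclic (hG : IsMetricOn G U) (hy : y ∈ U) :
    ∃ A : Fin n → Fin n → Fin n → ℝ, (∀ j k l, A k j l = -A j k l) ∧ ∀ i j k l m,
      covDeriv4 G (weyl G) i j k l m y + covDeriv4 G (weyl G) j k i l m y
        + covDeriv4 G (weyl G) k i j l m y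
      = G y i m * A j k l - G y i l * A j k m + G y j m * A k i l - G y j l * A k i m
        + G y k m * A i j l - G y k l * A i j m := by
  -- The witness is `∇_k P_{jl} - ∇_j P_{kl}` with `P` the Schouten tensor. Later steps use only its
  -- skewness.
  refine ⟨fun j k l => covDeriv2 G (schouten G) k j l y - covDeriv2 G (schouten G) j k l y,
    fun j k l => by ring, fun i j k l m => ?_⟩
  have h := hG.covDeriv4_riemannLow_cyclic hy i j k l m
  rw [hG.covDeriv4_weyl hy, hG.covDeriv4_weyl hy, hG.covDeriv4_weyl hy]
  linear_combination h

end IsMetricOn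

end Weyl

/-! ### Contractions at a point -/

section Contraction

variable {n : ℕ} {g : Matrix (Fin n) (Fin n) ℝ}

theorem trace2_add (F H : Fin n → Fin n → ℝ) :
    trace2 g (fun i m => F i m + H i m) = trace2 g F + trace2 g H := by
  simp only [trace2, mul_add, Finset.sum_add_distrib]

theorem trace2_sub (F H : Fin n → Fin n → ℝ) :
    trace2 g (fun i m => F i m - H i m) = trace2 g F - trace2 g H := by
  simp only [trace2, mul_sub, Finset.sum_sub_distrib]

theorem trace2_neg (F : Fin n → Fin n → ℝ) : trace2 g (fun i m => -F i m) = -trace2 g F := by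
  simp only [trace2, mul_neg, Finset.sum_neg_distrib]

theorem trace2_const_mul (c : ℝ) (F : Fin n → Fin n → ℝ) :
    trace2 g (fun i m => c * F i m) = c * trace2 g F := by
  simp only [trace2, Finset.mul_sum]
  exact Finset.sum_congr rfl fun i _ => Finset.sum_congr rfl fun m _ => by ring

theorem trace2_swap (hg : ∀ i j, g i j = g j i) (F : Fin n → Fin n → ℝ) :
    trace2 g (fun i m => F m i) = trace2 g F := by
  unfold trace2
  rw [Finset.sum_comm]
  exact Finset.sum_congr rfl fun i _ => Finset.sum_congr rfl fun m _ => by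
    rw [inv_symm_of_symm hg]

theorem sum_inv_mul (hdet : IsUnit g.det) (i l : Fin n) : ∑ m, g⁻¹ i m * g m l = kron i l := by
  have h := congrFun (congrFun (Matrix.nonsing_inv_mul g hdet) i) l
  rw [Matrix.mul_apply] at h
  rw [h, Matrix.one_apply]
  rfl

theorem trace2_mul_metric (hdet : IsUnit g.det) (f : Fin n → ℝ) (l : Fin n) :
    trace2 g (fun i m => g m l * f i) = f l := by
  have : ∀ i, ∑ m, g⁻¹ i m * (g m l * f i) = kron l i * f i := by
    intro i
    rw [show kron l i = kron i l by simp [kron, eq_comm], ← sum_inv_mul hdet, Finset.sum_mul]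
    exact Finset.sum_congr rfl fun m _ => by ring
  simp only [trace2, this, sum_kron_mul]

theorem trace2_metric_mul (hg : ∀ i j, g i j = g j i) (hdet : IsUnit g.det) (f : Fin n → ℝ)
    (l : Fin n) : trace2 g (fun i m => g i l * f m) = f l := by
  rw [← trace2_mul_metric hdet f l]
  exact trace2_swap hg (fun i m => g m l * f i)

theorem trace2_metric_mul_const (hg : ∀ i j, g i j = g j i) (hdet : IsUnit g.det) (c : ℝ) :
    trace2 g (fun i m => g i m * c) = n * c := by
  have : ∀ i, ∑ m, g⁻¹ i m * (g i m * c) = c := by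
    intro i
    simp only [hg i, ← mul_assoc, ← Finset.sum_mul]
    rw [sum_inv_mul hdet]
    simp [kron]
  simp [trace2, this]

theorem trace2_covector_mul (hg : ∀ i j, g i j = g j i) (a f : Fin n → ℝ) :
    trace2 g (fun i m => a i * f m) = ∑ m, raise g a m * f m := by
  unfold trace2 raise
  rw [Finset.sum_comm]
  refine Finset.sum_congr rfl fun m _ => ?_
  rw [Finset.sum_mul]
  refine Finset.sum_congr rfl fun i _ => ?_
  rw [inv_symm_of_symm hg i m]
  ring

theorem sum_raise_mul_metric (hg : ∀ i j, g i j = g j i) (hdet : IsUnit g.det) (a : Fin n → ℝ)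
    (l : Fin n) : ∑ i, raise g a i * g i l = a l := by
  rw [← trace2_covector_mul hg a fun i => g i l, ← trace2_mul_metric hdet a l]
  simp only [mul_comm]

theorem trace2_sum_mul (a : Fin n → ℝ) (F : Fin n → Fin n → Fin n → ℝ) :
    trace2 g (fun i m => ∑ p, a p * F i m p) = ∑ p, a p * trace2 g (fun i m => F i m p) := by
  simp only [trace2, Finset.mul_sum]
  rw [Finset.sum_congr rfl fun i _ => Finset.sum_comm, Finset.sum_comm]
  exact Finset.sum_congr rfl fun p _ => Finset.sum_congr rfl fun i _ =>
    Finset.sum_congr rfl fun m _ => by ring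

end Contraction

/-! ### The algebra of the recurrence condition -/

section Recurrence

variable {n : ℕ} {g : Matrix (Fin n) (Fin n) ℝ} {C : Fin n → Fin n → Fin n → Fin n → ℝ}
  {α : Fin n → ℝ} {A : Fin n → Fin n → Fin n → ℝ}

/-- The contraction `C_{jklm} α^m`. -/
noncomputable def contract (g : Matrix (Fin n) (Fin n) ℝ) (α : Fin n → ℝ)
    (C : Fin n → Fin n → Fin n → Fin n → ℝ) (j k l : Fin n) : ℝ :=
  ∑ m, raise g α m * C j k l m

/-- A trace-type Bianchi identity determines its right-hand side. -/
theorem contract_eq_of_bianchi (hn : 5 ≤ n) (hg : ∀ i j, g i j = g j i) (hdet : IsUnit g.det)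
    (hC : IsCurvatureLike C) (htr : ∀ k l, trace2 g (fun j m => C j k l m) = 0)
    (hA : ∀ j k l, A k j l = -A j k l)
    (hB : ∀ i j k l m, α i * C j k l m + α j * C k i l m + α k * C i j l m
      = g i m * A j k l - g i l * A j k m + g j m * A k i l - g j l * A k i m
        + g k m * A i j l - g k l * A i j m) (j k l : Fin n) :
    contract g α C j k l = ((n : ℝ) - 3) * A j k l := by
  have hn' : (5 : ℝ) ≤ n := by exact_mod_cast hn
  set t : Fin n → ℝ := fun k => trace2 g (fun i m => A k i m) with ht
  have hAt : ∀ k, trace2 g (fun i m => A i k m) = -t k := by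
    intro k
    rw [ht, ← trace2_neg]
    simp only [hA k]
  have hCl : ∀ k l, trace2 g (fun i m => C k i l m) = 0 := by
    intro k l
    have : (fun i m => C k i l m) = fun i m => -C i k l m := by
      funext i m; exact hC.antisymm_left i k l m
    rw [this, trace2_neg, htr, neg_zero]
  -- Trace over `i, m`: the coefficient `n - 3` is `n` from `g_{im}` and `-1` from each of the three
  -- terms where the metric relabels an index of `A`.
  have h1 : ∀ j k l, contract g α C j k l = ((n : ℝ) - 3) * A j k l - g j l * t k + g k l * t j := by
    intro j k l
    have h := congrArg (trace2 g) (funext fun i => funext fun m => hB i j k l m)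
    simp only [trace2_add, trace2_sub, trace2_const_mul, hg j, hg k,
      trace2_mul_metric hdet, trace2_metric_mul hg hdet, trace2_metric_mul_const hg hdet,
      trace2_covector_mul hg, htr, hCl, hAt] at h
    rw [hA j k] at h
    rw [hg j l, hg k l]
    simp only [contract, ht]
    linear_combination h
  -- Trace over `j, l`: the left side vanishes and the right side is `-(2n - 4) t_k`.
  have h2 : ∀ k, t k = 0 := by
    intro k
    have h := congrArg (trace2 g) (funext fun j => funext fun l => h1 j k l)
    have e0 : trace2 g (fun j l => contract g α C j k l) = 0 := by
      unfold contract
      have hz : ∀ m, trace2 g (fun j l => C j k l m) = 0 := by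
        intro m
        have : (fun j l => C j k l m) = fun j l => -C j k m l := by
          funext j l; exact hC.antisymm_right j k m l
        rw [this, trace2_neg, htr, neg_zero]
      simp only [trace2_sum_mul, hz, mul_zero, Finset.sum_const_zero]
    have e1 : trace2 g (fun j l => g k l * t j) = t k := by
      simp only [hg k]
      exact trace2_mul_metric hdet _ _
    rw [e0] at h
    simp only [trace2_add, trace2_sub, trace2_const_mul,
      trace2_metric_mul_const hg hdet, hAt, e1] at h
    have : (2 * (n : ℝ) - 4) * t k = 0 := by linear_combination h
    rcases mul_eq_zero.1 this with h' | h'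
    · linarith
    · exact h'
  rw [h1, h2, h2]
  ring

theorem electric_mul_normSqForm (hα : normSqForm g α ≠ 0) (i l : Fin n) :
    normSqForm g α * electric g α C i l = ∑ j, ∑ k, C i j k l * raise g α j * raise g α k := by
  unfold electric
  field_simp

theorem electric_symm (hC : IsCurvatureLike C) (i l : Fin n) :
    electric g α C i l = electric g α C l i := by
  unfold electric
  rw [Finset.sum_comm]
  congr 1
  refine Finset.sum_congr rfl fun k _ => Finset.sum_congr rfl fun j _ => ?_
  rw [hC.pair_symm i j k l, hC.antisymm_left l k i j, hC.antisymm_right l k j i]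
  ring

theorem trace2_electric (htr : ∀ k l, trace2 g (fun j m => C j k l m) = 0) :
    trace2 g (electric g α C) = 0 := by
  have h : electric g α C = fun i l => (normSqForm g α)⁻¹ *
      ∑ j, raise g α j * ∑ k, raise g α k * C i j k l := by
    funext i l
    simp only [electric, div_eq_inv_mul, Finset.mul_sum]
    exact Finset.sum_congr rfl fun j _ => Finset.sum_congr rfl fun k _ => by ring
  rw [h, trace2_const_mul, trace2_sum_mul]
  simp only [trace2_sum_mul, htr, mul_zero, Finset.sum_const_zero]

/-- The symmetric `α^l α^m` meets the skew last pair of `C`. -/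
theorem sum_raise_mul_contract (hC : IsCurvatureLike C) (j k : Fin n) :
    ∑ m, raise g α m * contract g α C j k m = 0 := by
  have h : ∑ m, raise g α m * contract g α C j k m
      = -∑ m, raise g α m * contract g α C j k m := by
    simp only [contract, Finset.mul_sum]
    conv_lhs => rw [Finset.sum_comm]
    simp only [← Finset.sum_neg_distrib]
    refine Finset.sum_congr rfl fun m _ => Finset.sum_congr rfl fun p _ => ?_
    rw [hC.antisymm_right j k m p]
    ring
  linarith

theorem sum_raise_mul_contract_middle (hC : IsCurvatureLike C) (hα : normSqForm g α ≠ 0)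
    (k l : Fin n) : ∑ i, raise g α i * contract g α C k i l
      = -(normSqForm g α * electric g α C k l) := by
  rw [electric_mul_normSqForm hα]
  simp only [contract, Finset.mul_sum, ← Finset.sum_neg_distrib]
  refine Finset.sum_congr rfl fun i _ => Finset.sum_congr rfl fun m _ => ?_
  rw [hC.antisymm_right k i m l]
  ring

theorem sum_raise_mul_electric (hC : IsCurvatureLike C) (hα : normSqForm g α ≠ 0) (k : Fin n) :
    ∑ m, raise g α m * electric g α C k m = 0 := by
  have h : normSqForm g α * ∑ m, raise g α m * electric g α C k m
      = -∑ i, raise g α i * ∑ m, raise g α m * contract g α C k i m := by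
    have h' : ∀ m, normSqForm g α * (raise g α m * electric g α C k m)
        = -∑ i, raise g α i * (raise g α m * contract g α C k i m) := by
      intro m
      rw [← mul_left_comm, ← neg_neg (normSqForm g α * electric g α C k m),
        ← sum_raise_mul_contract_middle hC hα, mul_neg, Finset.mul_sum]
      congr 1
      exact Finset.sum_congr rfl fun i _ => by ring
    simp only [Finset.mul_sum, h', Finset.sum_neg_distrib]
    rw [Finset.sum_comm]
  simp only [sum_raise_mul_contract hC, mul_zero, Finset.sum_const_zero, neg_zero] at h
  exact (mul_eq_zero.1 h).resolve_left hα

/-- The Weyl-type tensor is determined by its contractions with the recurrence covector. -/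
theorem electric_decomposition (hn : 5 ≤ n) (hg : ∀ i j, g i j = g j i) (hdet : IsUnit g.det)
    (hC : IsCurvatureLike C) (htr : ∀ k l, trace2 g (fun j m => C j k l m) = 0)
    (hA : ∀ j k l, A k j l = -A j k l)
    (hB : ∀ i j k l m, α i * C j k l m + α j * C k i l m + α k * C i j l m
      = g i m * A j k l - g i l * A j k m + g j m * A k i l - g j l * A k i m
        + g k m * A i j l - g k l * A i j m) (hα : normSqForm g α ≠ 0) (j k l m : Fin n) :
    C j k l m = kulkarniNomizu
        (fun a b => 1 / ((n : ℝ) - 3) *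
          (g a b - ((n : ℝ) - 2) * (α a * α b / normSqForm g α)))
        (electric g α C) j k l m := by
  have hn' : (5 : ℝ) ≤ n := by exact_mod_cast hn
  have hAD := contract_eq_of_bianchi hn hg hdet hC htr hA hB
  set a := raise g α with ha
  set s := normSqForm g α with hs
  set D := contract g α C with hD
  set E := electric g α C with hE
  have hag : ∀ l, ∑ i, a i * g i l = α l := sum_raise_mul_metric hg hdet α
  have hDa : ∀ j k, ∑ m, a m * D j k m = 0 := sum_raise_mul_contract hC
  have hDl : ∀ j l m, ∑ i, a i * C j i l m = D l m j := by
    intro j l m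
    exact Finset.sum_congr rfl fun i _ => by rw [hC.pair_symm]
  have hQ : ∀ k l, ∑ i, a i * D k i l = -(s * E k l) := sum_raise_mul_contract_middle hC hα
  have hEsymm : ∀ k l, E k l = E l k := electric_symm hC
  have hEa : ∀ k, ∑ m, a m * E k m = 0 := sum_raise_mul_electric hC hα
  -- Contraction of the identity with `α^i`, with `A` eliminated through `D = (n-3) A`.
  have h1 : ∀ j k l m, ((n : ℝ) - 3) * (s * C j k l m + α j * D l m k - α k * D l m j)
      = α m * D j k l - α l * D j k m - g j m * (s * E k l) + g j l * (s * E k m)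
        + g k m * (s * E j l) - g k l * (s * E j m) := by
    intro j k l m
    have hB' : ∀ i, ((n : ℝ) - 3) * (α i * C j k l m + α j * C k i l m - α k * C j i l m)
        = g i m * D j k l - g i l * D j k m + g j m * D k i l - g j l * D k i m
          - g k m * D j i l + g k l * D j i m := by
      intro i
      have hBi := hB i j k l m
      rw [hC.antisymm_left j i, hA j i, hA j i] at hBi
      simp only [hAD]
      linear_combination ((n : ℝ) - 3) * hBi
    have hL : ((n : ℝ) - 3) * ((∑ i, a i * α i) * C j k l m + α j * (∑ i, a i * C k i l m)
        - α k * ∑ i, a i * C j i l m)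
        = ∑ i, a i * (((n : ℝ) - 3) * (α i * C j k l m + α j * C k i l m - α k * C j i l m)) := by
      simp only [Finset.mul_sum, Finset.sum_mul, ← Finset.sum_add_distrib,
        ← Finset.sum_sub_distrib]
      exact Finset.sum_congr rfl fun i _ => by ring
    have hR : ∑ i, a i * (g i m * D j k l - g i l * D j k m + g j m * D k i l - g j l * D k i m
          - g k m * D j i l + g k l * D j i m)
        = (∑ i, a i * g i m) * D j k l - (∑ i, a i * g i l) * D j k m
          + g j m * (∑ i, a i * D k i l) - g j l * (∑ i, a i * D k i m)
          - g k m * (∑ i, a i * D j i l) + g k l * (∑ i, a i * D j i m) := by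
      simp only [Finset.mul_sum, Finset.sum_mul, ← Finset.sum_add_distrib,
        ← Finset.sum_sub_distrib]
      exact Finset.sum_congr rfl fun i _ => by ring
    simp only [hB', hR, hag, hQ, hDl] at hL
    have hs' : ∑ i, a i * α i = s := rfl
    rw [hs'] at hL
    linear_combination hL
  -- Contraction of `h1` with `α^m`. The term `α² D` has weight `n - 3` on the left and `1` on the
  -- right, whence the factor `n - 4`.
  have h2 : ∀ j k l, D j k l = α j * E k l - α k * E j l := by
    intro j k l
    have hL : ((n : ℝ) - 3) * (s * (∑ m, a m * C j k l m) + α j * (∑ m, a m * D l m k)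
        - α k * ∑ m, a m * D l m j)
        = ∑ m, a m * (((n : ℝ) - 3) * (s * C j k l m + α j * D l m k - α k * D l m j)) := by
      simp only [Finset.mul_sum, ← Finset.sum_add_distrib, ← Finset.sum_sub_distrib]
      exact Finset.sum_congr rfl fun i _ => by ring
    have hR : ∑ m, a m * (α m * D j k l - α l * D j k m - g j m * (s * E k l)
          + g j l * (s * E k m) + g k m * (s * E j l) - g k l * (s * E j m))
        = (∑ m, a m * α m) * D j k l - α l * (∑ m, a m * D j k m)
          - (∑ m, a m * g m j) * (s * E k l) + g j l * (s * ∑ m, a m * E k m)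
          + (∑ m, a m * g m k) * (s * E j l) - g k l * (s * ∑ m, a m * E j m) := by
      simp only [Finset.mul_sum, Finset.sum_mul, ← Finset.sum_add_distrib,
        ← Finset.sum_sub_distrib]
      exact Finset.sum_congr rfl fun i _ => by rw [hg j i, hg k i]; ring
    have hs' : ∑ i, a i * α i = s := rfl
    have hD' : ∑ m, a m * C j k l m = D j k l := rfl
    simp only [h1, hR, hag, hDa, hQ, hEa, hs', hD'] at hL
    rw [hEsymm l k, hEsymm l j] at hL
    have h4 : (((n : ℝ) - 4) * s) * (D j k l - (α j * E k l - α k * E j l)) = 0 := by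
      linear_combination hL
    have h5 : ((n : ℝ) - 4) * s ≠ 0 := mul_ne_zero (by linarith) hα
    linarith [(mul_eq_zero.1 h4).resolve_left h5]
  -- With `D` known in terms of `E`, `h1` is already the decomposition multiplied by `(n-3) α²`.
  have h3 := h1 j k l m
  rw [h2, h2, h2, h2, hEsymm m k, hEsymm l k, hEsymm m j, hEsymm l j] at h3
  have hn3 : (n : ℝ) - 3 ≠ 0 := by linarith
  simp only [kulkarniNomizu]
  field_simp
  linear_combination h3

end Recurrence

/-! ### Norms -/

section Norm

variable {n : ℕ} {g : Matrix (Fin n) (Fin n) ℝ} {C : Fin n → Fin n → Fin n → Fin n → ℝ}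
  {α : Fin n → ℝ}

/-- The tensor `C^{jklm}`. -/
noncomputable def raise4 (g : Matrix (Fin n) (Fin n) ℝ)
    (C : Fin n → Fin n → Fin n → Fin n → ℝ) (j k l m : Fin n) : ℝ :=
  ∑ p, ∑ q, ∑ r, ∑ s, g⁻¹ j p * g⁻¹ k q * g⁻¹ l r * g⁻¹ m s * C p q r s

theorem raise4_antisymm_left (hC : IsCurvatureLike C) (j k l m : Fin n) :
    raise4 g C k j l m = -raise4 g C j k l m := by
  unfold raise4
  rw [Finset.sum_comm]
  simp only [← Finset.sum_neg_distrib]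
  refine Finset.sum_congr rfl fun p _ => Finset.sum_congr rfl fun q _ =>
    Finset.sum_congr rfl fun r _ => Finset.sum_congr rfl fun s _ => ?_
  rw [hC.antisymm_left p q]
  ring

theorem raise4_antisymm_right (hC : IsCurvatureLike C) (j k l m : Fin n) :
    raise4 g C j k m l = -raise4 g C j k l m := by
  unfold raise4
  simp only [← Finset.sum_neg_distrib]
  refine Finset.sum_congr rfl fun p _ => Finset.sum_congr rfl fun q _ => ?_
  rw [Finset.sum_comm]
  refine Finset.sum_congr rfl fun r _ => Finset.sum_congr rfl fun s _ => ?_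
  rw [hC.antisymm_right p q r s]
  ring

/-- Contraction of a Kulkarni–Nomizu product with a tensor that is skew in its first and in its
last pair of indices. -/
theorem sum_kulkarniNomizu_mul {u S : Fin n → Fin n → ℝ} {W : Fin n → Fin n → Fin n → Fin n → ℝ}
    (hl : ∀ j k l m, W k j l m = -W j k l m) (hr : ∀ j k l m, W j k m l = -W j k l m) :
    ∑ j, ∑ k, ∑ l, ∑ m, kulkarniNomizu u S j k l m * W j k l m
      = 4 * ∑ j, ∑ l, S j l * ∑ k, ∑ m, u k m * W j k l m := by
  set X : (Fin n → Fin n → Fin n → Fin n → ℝ) → ℝ := fun F => ∑ j, ∑ k, ∑ l, ∑ m, F j k l m with hX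
  have swapl : ∀ F, X (fun j k l m => F k j l m) = X F := fun F => Finset.sum_comm
  have swapr : ∀ F, X (fun j k l m => F j k m l) = X F := fun F =>
    Finset.sum_congr rfl fun j _ => Finset.sum_congr rfl fun k _ => Finset.sum_comm
  set P : Fin n → Fin n → Fin n → Fin n → ℝ := fun j k l m => u k m * S j l * W j k l m with hP
  -- The four terms are relabellings of one; the signs are absorbed by the skewness of `W`.
  have h1 : X (fun j k l m => kulkarniNomizu u S j k l m * W j k l m)
      = X (fun j k l m => P k j m l) + X P + X (fun j k l m => P k j l m)
        + X (fun j k l m => P j k m l) := by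
    simp only [hX, ← Finset.sum_add_distrib]
    refine Finset.sum_congr rfl fun j _ => Finset.sum_congr rfl fun k _ =>
      Finset.sum_congr rfl fun l _ => Finset.sum_congr rfl fun m _ => ?_
    simp only [hP, kulkarniNomizu, hl j k, hr j k l m]
    ring
  have h2 : X (fun j k l m => P k j m l) = X P :=
    (swapl fun j k l m => P j k m l).trans (swapr P)
  have h3 : X P = ∑ j, ∑ l, S j l * ∑ k, ∑ m, u k m * W j k l m := by
    simp only [hX, hP]
    refine Finset.sum_congr rfl fun j _ => ?_
    rw [Finset.sum_comm]
    simp only [Finset.mul_sum]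
    exact Finset.sum_congr rfl fun l _ => Finset.sum_congr rfl fun k _ =>
      Finset.sum_congr rfl fun m _ => by ring
  have h4 : X (fun j k l m => kulkarniNomizu u S j k l m * W j k l m) = 4 * X P := by
    rw [h1, h2, swapl P, swapr P]
    ring
  rw [← h3, ← h4]

theorem sum_mul_sum_mul_comm {ι κ : Type*} [Fintype ι] [Fintype κ] (u : ι → ℝ) (v : κ → ℝ)
    (F : ι → κ → ℝ) : ∑ k, u k * ∑ p, v p * F k p = ∑ p, v p * ∑ k, u k * F k p := by
  simp only [Finset.mul_sum]
  rw [Finset.sum_comm]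
  exact Finset.sum_congr rfl fun p _ => Finset.sum_congr rfl fun k _ => by ring

/-- Contracting raised indices of `C` with `u` is contracting `C` with the raised `u`. -/
theorem sum_mul_raise4 (u : Fin n → Fin n → ℝ) (j l : Fin n) :
    ∑ k, ∑ m, u k m * raise4 g C j k l m
      = ∑ p, ∑ r, g⁻¹ j p * g⁻¹ l r *
        ∑ q, ∑ s, (∑ k, ∑ m, g⁻¹ k q * g⁻¹ m s * u k m) * C p q r s := by
  -- Packing indices in pairs turns the reordering of many sums into one exchange of two.
  have h1 : ∀ k m, raise4 g C j k l m = ∑ x : Fin n × Fin n, g⁻¹ j x.1 * g⁻¹ l x.2 *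
      ∑ z : Fin n × Fin n, g⁻¹ k z.1 * g⁻¹ m z.2 * C x.1 z.1 x.2 z.2 := by
    intro k m
    simp only [Fintype.sum_prod_type, Finset.mul_sum, raise4]
    refine Finset.sum_congr rfl fun p _ => ?_
    rw [Finset.sum_comm]
    exact Finset.sum_congr rfl fun r _ => Finset.sum_congr rfl fun q _ =>
      Finset.sum_congr rfl fun s _ => by ring
  have h2 : ∑ w : Fin n × Fin n, u w.1 w.2 * ∑ x : Fin n × Fin n, g⁻¹ j x.1 * g⁻¹ l x.2 *
      ∑ z : Fin n × Fin n, g⁻¹ w.1 z.1 * g⁻¹ w.2 z.2 * C x.1 z.1 x.2 z.2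
      = ∑ x : Fin n × Fin n, g⁻¹ j x.1 * g⁻¹ l x.2 * ∑ z : Fin n × Fin n,
        (∑ w : Fin n × Fin n, g⁻¹ w.1 z.1 * g⁻¹ w.2 z.2 * u w.1 w.2) * C x.1 z.1 x.2 z.2 := by
    rw [sum_mul_sum_mul_comm]
    refine Finset.sum_congr rfl fun x _ => ?_
    congr 1
    simp only [Finset.mul_sum, Finset.sum_mul]
    rw [Finset.sum_comm]
    exact Finset.sum_congr rfl fun z _ => Finset.sum_congr rfl fun w _ => by ring
  simp only [← h1] at h2
  simpa only [Fintype.sum_prod_type] using h2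

theorem normSq4_eq_of_decomposition (hg : ∀ i j, g i j = g j i) (hdet : IsUnit g.det)
    (hC : IsCurvatureLike C) (htr : ∀ k l, trace2 g (fun j m => C j k l m) = 0)
    (hα : normSqForm g α ≠ 0)
    (hdec : ∀ j k l m, C j k l m = kulkarniNomizu
        (fun a b => 1 / ((n : ℝ) - 3) *
          (g a b - ((n : ℝ) - 2) * (α a * α b / normSqForm g α)))
        (electric g α C) j k l m) :
    normSq4 g C = 4 * (((n : ℝ) - 2) / ((n : ℝ) - 3)) * normSq2 g (electric g α C) := by
  set s := normSqForm g α with hs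
  set u : Fin n → Fin n → ℝ := fun a b => 1 / ((n : ℝ) - 3) *
    (g a b - ((n : ℝ) - 2) * (α a * α b / s)) with hu
  have h0 : normSq4 g C = ∑ j, ∑ k, ∑ l, ∑ m,
      kulkarniNomizu u (electric g α C) j k l m * raise4 g C j k l m := by
    simp only [← hdec]
    rfl
  have hup : ∀ q r, ∑ k, ∑ m, g⁻¹ k q * g⁻¹ m r * u k m = 1 / ((n : ℝ) - 3) *
      (g⁻¹ q r - ((n : ℝ) - 2) / s * (raise g α q * raise g α r)) := by
    intro q r
    have e1 : ∑ k, ∑ m, g⁻¹ k q * g⁻¹ m r * g k m = g⁻¹ q r := by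
      have h : (g⁻¹ * g * g⁻¹) q r = g⁻¹ q r := by
        rw [Matrix.nonsing_inv_mul g hdet, one_mul]
      simp only [Matrix.mul_apply] at h
      rw [← h, Finset.sum_comm]
      refine Finset.sum_congr rfl fun m _ => ?_
      rw [Finset.sum_mul]
      exact Finset.sum_congr rfl fun k _ => by rw [inv_symm_of_symm hg k q]; ring
    have e2 : ∑ k, ∑ m, g⁻¹ k q * g⁻¹ m r * (α k * α m) = raise g α q * raise g α r := by
      unfold raise
      rw [Finset.sum_mul_sum]
      exact Finset.sum_congr rfl fun k _ => Finset.sum_congr rfl fun m _ => by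
        rw [inv_symm_of_symm hg k q, inv_symm_of_symm hg m r]; ring
    rw [← e1, ← e2]
    simp only [Finset.mul_sum, ← Finset.sum_sub_distrib]
    refine Finset.sum_congr rfl fun k _ => Finset.sum_congr rfl fun m _ => ?_
    simp only [hu]
    ring
  -- The metric part of `u` contracts to zero; the part `-(n-2)/(n-3) α⊗α/α²` meets `C_{pqrt} α^q
  -- α^t = -α² E_{pr}`.
  have hcon : ∀ p r, ∑ q, ∑ t, (∑ k, ∑ m, g⁻¹ k q * g⁻¹ m t * u k m) * C p q r t
      = ((n : ℝ) - 2) / ((n : ℝ) - 3) * electric g α C p r := by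
    intro p r
    have e1 : ∑ q, ∑ t, g⁻¹ q t * C p q r t = 0 := by
      rw [← neg_zero, ← htr p r, ← trace2_neg]
      exact Finset.sum_congr rfl fun q _ => Finset.sum_congr rfl fun t _ => by
        rw [hC.antisymm_left q p]
    have e2 : ∑ q, ∑ t, raise g α q * raise g α t * C p q r t = -(s * electric g α C p r) := by
      rw [hs, electric_mul_normSqForm hα]
      simp only [← Finset.sum_neg_distrib]
      exact Finset.sum_congr rfl fun q _ => Finset.sum_congr rfl fun t _ => by
        rw [hC.antisymm_right p q t r]; ring
    have e3 : ∑ q, ∑ t, (∑ k, ∑ m, g⁻¹ k q * g⁻¹ m t * u k m) * C p q r t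
        = 1 / ((n : ℝ) - 3) * (∑ q, ∑ t, g⁻¹ q t * C p q r t
          - ((n : ℝ) - 2) / s * ∑ q, ∑ t, raise g α q * raise g α t * C p q r t) := by
      simp only [hup, Finset.mul_sum, ← Finset.sum_sub_distrib]
      exact Finset.sum_congr rfl fun q _ => Finset.sum_congr rfl fun t _ => by ring
    rw [e3, e1, e2]
    field_simp
    ring
  rw [h0, sum_kulkarniNomizu_mul (raise4_antisymm_left hC) (raise4_antisymm_right hC), mul_assoc]
  congr 1
  simp only [sum_mul_raise4, hcon, normSq2, Finset.mul_sum]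
  exact Finset.sum_congr rfl fun j _ => Finset.sum_congr rfl fun l _ =>
    Finset.sum_congr rfl fun p _ => Finset.sum_congr rfl fun r _ => by ring

end Norm

/-! ### From the coordinate results to the manifold -/

theorem PseudoRiemannianMetric.isMetricOn_comp {n : ℕ} {M : Type*} [TopologicalSpace M]
    [ChartedSpace (Coord n) M] [IsManifold (𝓡 n) ∞ M] (g : PseudoRiemannianMetric n M)
    {e : OpenPartialHomeomorph M (Coord n)} (he : e ∈ IsManifold.maximalAtlas (𝓡 n) ∞ M) :
    IsMetricOn (g.comp e) e.target where
  isOpen := e.open_target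
  smooth := g.contDiffOn_comp he
  symm := g.comp_symm e
  isUnit_det _ hz := g.isUnit_det_comp he hz

theorem mainTheorem1 {n : ℕ} (hn : 5 ≤ n) {M : Type*} [TopologicalSpace M] [T2Space M]
    [ConnectedSpace M] [ChartedSpace (Coord n) M] [IsManifold (𝓡 n) ∞ M]
    (g : PseudoRiemannianMetric n M) (α : CovectorField n M)
    (hCR : IsConformallyRecurrent g α)
    (e : OpenPartialHomeomorph M (Coord n)) (he : e ∈ IsManifold.maximalAtlas (𝓡 n) ∞ M)
    (y : Coord n) (hy : y ∈ e.target) (hα : α.sq g e y ≠ 0) :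
    (∀ i l, g.electricComp α e y i l = g.electricComp α e y l i) ∧
    trace2 (g.comp e y) (g.electricComp α e y) = 0 ∧
    (∀ j k l m, g.weylComp e y j k l m =
      kulkarniNomizu
        (fun a b => 1 / ((n : ℝ) - 3) *
          (g.comp e y a b - ((n : ℝ) - 2) * (α.comp e y a * α.comp e y b / α.sq g e y)))
        (g.electricComp α e y) j k l m) ∧
    normSq4 (g.comp e y) (g.weylComp e y) =
      4 * (((n : ℝ) - 2) / ((n : ℝ) - 3)) * normSq2 (g.comp e y) (g.electricComp α e y) := by
  have hG := g.isMetricOn_comp he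
  obtain ⟨A, hA, hB⟩ := hG.covDeriv4_weyl_cyclic hy
  have hC : IsCurvatureLike (g.weylComp e y) := hG.weyl_isCurvatureLike hy
  have htr : ∀ k l, trace2 (g.comp e y) (fun j m => g.weylComp e y j k l m) = 0 :=
    hG.trace2_weyl hy hn
  -- Recurrence enters here only, turning the Bianchi-type identity into an algebraic one at `y`.
  have hB' : ∀ i j k l m, α.comp e y i * g.weylComp e y j k l m
      + α.comp e y j * g.weylComp e y k i l m + α.comp e y k * g.weylComp e y i j l m
      = g.comp e y i m * A j k l - g.comp e y i l * A j k m + g.comp e y j m * A k i l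
        - g.comp e y j l * A k i m + g.comp e y k m * A i j l - g.comp e y k l * A i j m := by
    intro i j k l m
    rw [← hB]
    simp only [hCR.recurrent e he y hy, PseudoRiemannianMetric.weylComp]
  have hdec := electric_decomposition hn (g.comp_symm e y) (hG.isUnit_det y hy) hC htr hA hB' hα
  exact ⟨electric_symm hC, trace2_electric htr, hdec,
    normSq4_eq_of_decomposition (g.comp_symm e y) (hG.isUnit_det y hy) hC htr hα hdec⟩
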